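/- Let $K$ be $\mathbb{R}$ with its usual absolute value or a non-archimedean local field with its normalised absolute value ($|t| = 1/\#k$ for a uniformizer $t$, where $k$ is the finite residue field). Give $K^n$ the maximum norm; Hausdorff dimension is taken with respect to it. **Landmark pairs.** Let $0<r<1$, $0<\sigma\le\gamma$, let $D$ be a real number, let $\Omega\subset K$ be compact and $g:K^N\to K$. A *weak approximate landmark pair with parameters $(r,\gamma,\sigma)$, of degree $D$, adapted to $g$ on $\Omega$* is a pair of functions $\ell_1,\ell_2:K\to\{0,1,2,\dots\}\cup\{\infty\}$ such that: * (Separation) for every $\epsilon>0$ there is $C_1>0$ such that for every integer $j\ge 0$ the ball $B(0;C_1^{-1}r^{\gamma j(1+\epsilon)})$ contains no $y\neq 0$ with $\ell_2(y)\le j$; * (Ubiquity) for every $\epsilon>0$ there is $C_2>0$ such that for every $x\in\Omega$ and every integer $k>0$ there is $y\in B(x;C_2r^{(\sigma-\epsilon)k})$ with $\ell_1(y)\le k$; * (Approximation) there are an infinite set $J\subset\mathbb{N}$, a number $\delta>0$ and a function $e:\mathbb{N}\to\mathbb{R}$ with $e(j)=o(j)$ such that for all $j\in J$ and all $x_1,\dots,x_N\in\Omega$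 with $\max_i\ell_1(x_i)\le j$ there is $y\in K$ with $\ell_2(y)\le Dj+e(j)$ and $|y-g(x_1,\dots,x_N)|\le r^{(\gamma D+\delta)j}$. A function is $0$ times strictly differentiable without any condition. It is $m+1$ times strictly differentiable if it is strictly differentiable at every point and all its first-order partial derivatives are $m$ times strictly differentiable. **Theorem.** Let $n\ge 0$, let $B\subset K^n$ be a ball of positive radius, and let $0<r<1$, $0<\sigma\le\gamma$ and $d$ be real numbers with $\sigma\le d\gamma$ (automatic if $d\ge 1$). Let $f_q:(K^n)^{v_q}\to K$, $q\in\mathbb{N}$, be functions of $v_q$ points $x^{(1)},\dots,x^{(v_q)}\in K^n$. For each $q$ let $p_{q,1},\dots,p_{q,m_q}$ be a finite sequence (possibly empty) of the scalar coordinates $x^{(k)}_i$, and put $D_{0,q}f_q=f_q$ and $D_{j,q}f_q=\frac{\partial}{\partial p_{q,j}}(D_{j-1,q}f_q)$ for $1\le j\le m_q$; thus $D_{m_q,q}=\partial^{\alpha_q}$, where the multi-index $\alpha_q$ counts the occurrences of each coordinate and $|\alpha_q|=m_q$. Assume that 1. $f_q$ is $|\alpha_q|$ times strictly differentiable, and $\partial^{\alpha_q}f_q=D_{m_q,q}f_q$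 does not vanish at any point of $B^{v_q}$, for every $q$; 2. there is a sequence of positive real numbers $\epsilon_m\to 0$ such that, for all $q$, all $m$ and all $0\le j<|\alpha_q|$, there is a weak approximate landmark pair with parameters $(r,\gamma,\sigma)$, of degree $d+\epsilon_m$, adapted to $D_{j,q}f_q$ (as a function of $nv_q$ variables in $K$) on some compact set $\Omega_{q,m,j}\subset K$ that contains every coordinate of every point of $B$. Then there is a set $E\subset B$ of Hausdorff dimension $\frac{n\sigma}{d\gamma}$ such that for every $q$ there are no $v_q$ distinct points $x^{(1)},\dots,x^{(v_q)}\in E$ with $f_q(x^{(1)},\dots,x^{(v_q)})=0$. -/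

import Mathlib

open Filter Topology

namespace Landmark

/-- `K` is a non-archimedean local field with its normalised absolute value: the norm is
ultrametric and complete, the closed unit ball `R` is a discrete valuation ring with finite residue
field, and every uniformizer `t` of `R` has `‖t‖ = 1 / q`, where `q` is the number of elements of
the residue field. -/
class IsNormalizedNonarchLocalField (K : Type*) [NontriviallyNormedField K] : Prop extends
    IsUltrametricDist K where
  complete : CompleteSpace K
  dvr : IsDiscreteValuationRing (NormedField.valuation (K := K)).valuationSubring
  finite_residueField :
    Finite (IsLocalRing.ResidueField (NormedField.valuation (K := K)).valuationSubring)
  norm_uniformizer : ∀ t : (NormedField.valuation (K := K)).valuationSubring, Irreducible t →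
    ‖(t : K)‖ = ((Nat.card
      (IsLocalRing.ResidueField (NormedField.valuation (K := K)).valuationSubring) : ℕ) : ℝ)⁻¹

/-- `K` is the field of real numbers (with its usual absolute value, up to an isometric
isomorphism) or a non-archimedean local field. -/
def IsRealOrNonarchLocalField (K : Type*) [NontriviallyNormedField K] : Prop :=
  (∃ e : K ≃+* ℝ, ∀ x : K, ‖e x‖ = ‖x‖) ∨ IsNormalizedNonarchLocalField K

/-- Separation property with parameters `r, γ`: for every `ε > 0` there is `C > 0` such that, for
all `j`, the ball `B(0; C⁻¹ r ^ (γ j (1 + ε)))` contains no nonzero `y` with `ℓ₂ y ≤ j`. -/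
def Separated {Y : Type*} [MetricSpace Y] [Zero Y] (r γ : ℝ) (ℓ₂ : Y → ℕ∞) : Prop :=
  ∀ ε : ℝ, 0 < ε → ∃ C : ℝ, 0 < C ∧ ∀ (j : ℕ) (y : Y),
    y ∈ Metric.ball (0 : Y) (C⁻¹ * r ^ (γ * (j : ℝ) * (1 + ε))) → ℓ₂ y ≤ (j : ℕ∞) → y = 0

/-- Ubiquity property on `Ω` with parameters `r, σ`: for every `ε > 0` there is `C > 0` such that,
for all `x ∈ Ω` and all integers `k > 0`, the ball `B(x; C r ^ ((σ - ε) k))` contains some `y` with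
`ℓ₁ y ≤ k`. -/
def Ubiquitous {X : Type*} [MetricSpace X] (r σ : ℝ) (ℓ₁ : X → ℕ∞) (Ω : Set X) : Prop :=
  ∀ ε : ℝ, 0 < ε → ∃ C : ℝ, 0 < C ∧ ∀ x ∈ Ω, ∀ k : ℕ, 0 < k →
    ∃ y ∈ Metric.ball x (C * r ^ ((σ - ε) * (k : ℝ))), ℓ₁ y ≤ (k : ℕ∞)

/-- `(ℓ₁, ℓ₂)` is a weak approximate landmark pair with parameters `(r, γ, σ)`, of degree `d`,
adapted to the function `f` of the variables `(x i)_{i : ι}` in `X`, on `Ω`. The function `err` is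
the error term `o(j)`. -/
structure IsWeakApproxLandmarkPair {ι X Y : Type*} [MetricSpace X] [MetricSpace Y] [Zero Y]
    (r γ σ d : ℝ) (Ω : Set X) (f : (ι → X) → Y) (ℓ₁ : X → ℕ∞) (ℓ₂ : Y → ℕ∞) : Prop where
  separated : Separated r γ ℓ₂
  ubiquitous : Ubiquitous r σ ℓ₁ Ω
  approx : ∃ (J : Set ℕ) (δ : ℝ) (err : ℕ → ℝ), J.Infinite ∧ 0 < δ ∧
    err =o[atTop] (fun j : ℕ => (j : ℝ)) ∧
    ∀ j ∈ J, ∀ x : ι → X, (∀ i, x i ∈ Ω) → (∀ i, ℓ₁ (x i) ≤ (j : ℕ∞)) →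
      ∃ (y : Y) (N : ℕ), ℓ₂ y = (N : ℕ∞) ∧ (N : ℝ) ≤ d * (j : ℝ) + err j ∧
        dist y (f x) ≤ r ^ ((γ * d + δ) * (j : ℝ))

section Derivatives

variable {K : Type*} [NontriviallyNormedField K] {v n : ℕ}

/-- The partial derivative of `f` with respect to the coordinate `x_i^{(k)}`, where `p = (k, i)`. -/
noncomputable def pderiv (p : Fin v × Fin n) (f : (Fin v → Fin n → K) → K) :
    (Fin v → Fin n → K) → K :=
  fun x => lineDeriv K f x (Pi.single p.1 (Pi.single p.2 1))

/-- `f` is `m` times strictly differentiable: it is strictly differentiable at every point and all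
its partial derivatives are `m - 1` times strictly differentiable (no condition if `m = 0`). -/
def StrictlyDifferentiable : ℕ → ((Fin v → Fin n → K) → K) → Prop
  | 0, _ => True
  | m + 1, f =>
      (∀ x, ∃ f' : (Fin v → Fin n → K) →L[K] K, HasStrictFDerivAt f f' x) ∧
        ∀ p : Fin v × Fin n, StrictlyDifferentiable m (pderiv p f)

/-- The differential operator obtained by differentiating successively with respect to the
coordinates in the list `c`: the empty list gives the identity, and appending a coordinate `p` to
`c` gives `∂/∂p` applied to the result for `c`. It is the operator `∂^α` for the multi-index `α`
counting how often each coordinate occurs in `c`, and `|α|` is the length of `c`; the operators for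
`c.take 0, c.take 1, …` form the chain from the identity to `∂^α`. -/
noncomputable def chainDeriv (c : List (Fin v × Fin n)) (f : (Fin v → Fin n → K) → K) :
    (Fin v → Fin n → K) → K :=
  c.foldl (fun g p => pderiv p g) f

end Derivatives

end Landmark

/-! The set is a Cantor set whose balls are placed near landmarks. Let g = D_{j,q} f_q, and suppose
that its partial derivative in the coordinate p has no zero on a product of current balls. Take a
small scale t = r^i with i ∈ J. By ubiquity, the points w whose coordinates satisfy ℓ₁ ≤ i are dense
at scale t^(σ-ε). The value g(w) lies within t^(γD+δ) of some y with ℓ₂ y ≤ Di + o(i), and by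
separation either y = 0 or |y| is at least about t^(γD+δ'/2). The new centres are the points w,
shifted in the coordinate p by τ with |τ| ≈ t^(γD+δ') and 0 < δ' < δ; the new radius is a small
multiple of |τ|. A zero of g on the new balls would make |g(w)| comparable with |τ|, which is too
large if y = 0 and too small if y ≠ 0. So nonvanishing passes from ∂g/∂p to g
(`eventually_ne_zero_of_landmark`, `exists_step_of_landmarks`), and repeating this along the chain
reaches f_q.

All points of a tuple lie in the same Cantor set, yet only one of them may be shifted. A step
therefore also carries a set U from a countable basis, and shifts only the children of balls centred
in U. For distinct points some U isolates the one to be moved, and each triple (q, j, U) recurs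
infinitely often, so the required steps occur in the required order
(`IsCantorScheme.ne_zero_of_chain`).

Up to small losses in the exponents, a step puts t^(-nσ) balls of radius t^(γd) into each old ball.
As t is chosen after the old level, the number and size of the old balls do not matter, and the
growth exponent is nσ/(dγ). Covering by the balls of one level bounds the dimension above
(`IsCantorScheme.dimH_limitSet_le`); an equidistributed mass and packing bounds bound it below
(`IsCantorScheme.le_dimH_limitSet`). -/

namespace Landmark

open MeasureTheory Metric

/-! ### Measures on `K` with balls of mass comparable to the radius -/

section LocalField

variable {K : Type*} [NontriviallyNormedField K]

/-- The digits represent the residue classes of the closed unit ball: elements of one class differ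
by a multiple of the uniformizer `t`, elements of distinct classes by a unit, which has norm 1. -/
theorem IsNormalizedNonarchLocalField.exists_digits (h : IsNormalizedNonarchLocalField K) :
    ∃ (q : ℕ) (t : K) (s : Fin q → K), 0 < ‖t‖ ∧ ‖t‖ < 1 ∧ ‖t‖ = (q : ℝ)⁻¹ ∧ (∀ i, ‖s i‖ ≤ 1) ∧
      (∀ x : K, ‖x‖ ≤ 1 → ∃ i, ‖x - s i‖ ≤ ‖t‖) ∧
      ∀ i j, i ≠ j → ‖t‖ < ‖s i - s j‖ := by
  have := h.dvr
  have hfin := h.finite_residueField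
  set O := (NormedField.valuation (K := K)).valuationSubring with hO
  have memO : ∀ x : K, x ∈ O ↔ ‖x‖ ≤ 1 := fun x => by
    rw [hO, Valuation.mem_valuationSubring_iff, NormedField.valuation_apply, ← NNReal.coe_le_coe]
    simp
  obtain ⟨t, ht⟩ := IsDiscreteValuationRing.exists_irreducible O
  have hnorm := h.norm_uniformizer t ht
  have unit_norm : ∀ x : O, IsUnit x → ‖(x : K)‖ = 1 := by
    rintro x ⟨u, rfl⟩
    have h1 : ((u : O) : K) * ((u⁻¹ : Oˣ) : O) = 1 := by
      exact congrArg (Subtype.val : O → K) u.mul_inv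
    have h2 := congrArg norm h1
    rw [norm_mul, norm_one] at h2
    have h3 := (memO _).1 (u : O).2
    have h4 := (memO _).1 ((u⁻¹ : Oˣ) : O).2
    nlinarith [norm_nonneg ((u : O) : K), norm_nonneg (((u⁻¹ : Oˣ) : O) : K)]
  have norm_unit : ∀ x : O, ‖(x : K)‖ = 1 → IsUnit x := by
    intro x hx
    have hx0 : (x : K) ≠ 0 := by
      intro h0
      simp [h0] at hx
    have : (x : K)⁻¹ ∈ O := by
      rw [memO, norm_inv, hx, inv_one]
    exact IsUnit.of_mul_eq_one ⟨(x : K)⁻¹, this⟩ (Subtype.ext (mul_inv_cancel₀ hx0))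
  have max_iff : ∀ x : O, x ∈ IsLocalRing.maximalIdeal O → ‖(x : K)‖ ≤ ‖(t : K)‖ := by
    intro x hx
    rw [ht.maximalIdeal_eq, Ideal.mem_span_singleton] at hx
    obtain ⟨y, rfl⟩ := hx
    have := (memO _).1 y.2
    have h1 : ((t * y : O) : K) = (t : K) * (y : K) := rfl
    rw [h1, norm_mul]
    nlinarith [norm_nonneg (t : K)]
  have ht0 : 0 < ‖(t : K)‖ := by
    rw [norm_pos_iff]
    intro h0
    exact ht.ne_zero (Subtype.ext h0)
  have ht1 : ‖(t : K)‖ < 1 := by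
    refine lt_of_le_of_ne ((memO _).1 t.2) fun h1 => ht.not_isUnit (norm_unit t h1)
  obtain ⟨sec, hsec⟩ := (IsLocalRing.residue_surjective (R := O)).hasRightInverse
  let e := Finite.equivFin (IsLocalRing.ResidueField O)
  refine ⟨Nat.card (IsLocalRing.ResidueField O), t,
    fun i => (sec (e.symm i) : O), ht0, ht1, hnorm,
    fun i => (memO _).1 (Subtype.prop _), ?_, ?_⟩
  · intro x hx
    refine ⟨e (IsLocalRing.residue O ⟨x, (memO x).2 hx⟩), ?_⟩
    have := max_iff (⟨x, (memO x).2 hx⟩ - sec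
      (e.symm (e (IsLocalRing.residue O ⟨x, (memO x).2 hx⟩)))) (by
        rw [← IsLocalRing.residue_eq_zero_iff, map_sub, hsec]
        simp)
    simpa using this
  · intro i j hij
    have hu : IsUnit ((sec (e.symm i) : O) -
        sec (e.symm j)) := by
      rw [← IsLocalRing.residue_ne_zero_iff_isUnit, map_sub, hsec, hsec, sub_ne_zero]
      exact fun h => hij (e.symm.injective h)
    have := unit_norm _ hu
    calc ‖(t : K)‖ < 1 := ht1
      _ = _ := this.symm

theorem IsNormalizedNonarchLocalField.properSpace (h : IsNormalizedNonarchLocalField K) :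
    ProperSpace K := by
  let _ : Valued K NNReal := NormedField.toValued
  let _ : (Valued.v : Valuation K NNReal).RankOne :=
    inferInstanceAs (NormedField.valuation (K := K)).RankOne
  have hc := h.complete
  have h2 : CompactSpace (Valued.integer K) := by
    have hcl : IsClosed {x : K | ‖x‖ ≤ 1} := isClosed_le continuous_norm continuous_const
    refine Valued.integer.compactSpace_iff_completeSpace_and_isDiscreteValuationRing_and_finite_residueField.2
      ⟨?_, h.dvr, h.finite_residueField⟩
    have : IsClosed ((Valued.integer K : Set K)) := Valued.isClosed_integer K
    exact this.completeSpace_coe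
  have h3 : IsCompact (Valued.integer K : Set K) := isCompact_iff_compactSpace.2 h2
  have h4 : (Valued.integer K : Set K) = closedBall 0 1 := by
    ext x
    rw [SetLike.mem_coe, Valuation.mem_integer_iff, mem_closedBall, dist_zero_right,
      NormedField.v_eq_valuation, NormedField.valuation_apply, ← NNReal.coe_le_coe]
    simp
  rw [h4] at h3
  have : LocallyCompactSpace K := IsCompact.locallyCompactSpace_of_mem_nhds_of_addGroup h3
    (closedBall_mem_nhds 0 zero_lt_one)
  exact .of_nontriviallyNormedField_of_weaklyLocallyCompactSpace K

/-- The first digit splits the larger ball into `q` disjoint translates of the smaller one. -/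
theorem IsNormalizedNonarchLocalField.measure_closedBall_pow [MeasurableSpace K] [BorelSpace K]
    {q : ℕ} {t : K} {s : Fin q → K} (h : IsUltrametricDist K) (ht₀ : 0 < ‖t‖)
    (hs : ∀ i, ‖s i‖ ≤ 1) (hcover : ∀ x : K, ‖x‖ ≤ 1 → ∃ i, ‖x - s i‖ ≤ ‖t‖)
    (hsep : ∀ i j, i ≠ j → ‖t‖ < ‖s i - s j‖) (ht₁ : ‖t‖ < 1) (μ : Measure K)
    [μ.IsAddLeftInvariant] (k : ℕ) :
    μ (closedBall 0 (‖t‖ ^ k)) = q * μ (closedBall 0 (‖t‖ ^ (k + 1))) := by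
  have htk : 0 < ‖t‖ ^ k := pow_pos ht₀ k
  have ht : t ^ k ≠ 0 := pow_ne_zero k (norm_pos_iff.1 ht₀)
  have hU : closedBall (0 : K) (‖t‖ ^ k) =
      ⋃ i : Fin q, closedBall (t ^ k * s i) (‖t‖ ^ (k + 1)) := by
    ext x
    simp only [mem_closedBall, Set.mem_iUnion, dist_eq_norm, sub_zero]
    constructor
    · intro hx
      obtain ⟨i, hi⟩ := hcover (x / t ^ k) (by
        rw [norm_div, norm_pow]; exact (div_le_one htk).2 hx)
      refine ⟨i, ?_⟩
      have : x - t ^ k * s i = t ^ k * (x / t ^ k - s i) := by field_simp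
      rw [this, norm_mul, norm_pow, pow_succ]
      exact mul_le_mul_of_nonneg_left hi htk.le
    · rintro ⟨i, hi⟩
      have h1 : ‖t ^ k * s i‖ ≤ ‖t‖ ^ k := by
        rw [norm_mul, norm_pow]
        exact mul_le_of_le_one_right htk.le (hs i)
      have h2 : ‖t‖ ^ (k + 1) ≤ ‖t‖ ^ k := pow_le_pow_of_le_one ht₀.le ht₁.le (Nat.le_succ k)
      calc ‖x‖ = ‖(x - t ^ k * s i) + t ^ k * s i‖ := by rw [sub_add_cancel]
        _ ≤ max ‖x - t ^ k * s i‖ ‖t ^ k * s i‖ := IsUltrametricDist.norm_add_le_max _ _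
        _ ≤ ‖t‖ ^ k := max_le (hi.trans h2) h1
  have hdisj : Pairwise fun i j : Fin q =>
      Disjoint (closedBall (t ^ k * s i) (‖t‖ ^ (k + 1)))
        (closedBall (t ^ k * s j) (‖t‖ ^ (k + 1))) := by
    intro i j hij
    rw [Set.disjoint_left]
    intro x hx hy
    rw [mem_closedBall] at hx hy
    have h1 : dist (t ^ k * s i) (t ^ k * s j) ≤ ‖t‖ ^ (k + 1) :=
      (dist_triangle_max _ x _).trans (max_le (by rwa [dist_comm]) hy)
    rw [dist_eq_norm, ← mul_sub, norm_mul, norm_pow, pow_succ] at h1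
    exact absurd (le_of_mul_le_mul_left h1 htk) (not_le.2 (hsep i j hij))
  have htrans : ∀ c : K, μ (closedBall c (‖t‖ ^ (k + 1))) = μ (closedBall 0 (‖t‖ ^ (k + 1))) := by
    intro c
    rw [← measure_preimage_add μ c, preimage_add_closedBall, sub_self]
  rw [hU, measure_iUnion hdisj fun i => measurableSet_closedBall, tsum_fintype]
  simp [htrans]

/-- The normalisation `‖t‖ = 1 / q` matches the splitting into `q` translates, so Haar measure is
exactly proportional to the radius on balls of radius `‖t‖ ^ k`. Rounding a radius to such a power
costs a factor `‖t‖`. -/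
theorem IsNormalizedNonarchLocalField.exists_regular_measure [MeasurableSpace K] [BorelSpace K]
    (h : IsNormalizedNonarchLocalField K) :
    ∃ (μ : Measure K) (a b : ℝ), SigmaFinite μ ∧ 0 < a ∧ 0 < b ∧ ∀ (x : K) (R : ℝ), 0 < R → R ≤ 1 →
      ENNReal.ofReal (a * R) ≤ μ (ball x R) ∧ μ (ball x R) ≤ ENNReal.ofReal (b * R) := by
  have := h.properSpace
  obtain ⟨q, t, s, ht₀, ht₁, htq, hs, hcover, hsep⟩ := h.exists_digits
  let μ : Measure K := Measure.addHaar
  have hstep := IsNormalizedNonarchLocalField.measure_closedBall_pow h.toIsUltrametricDist ht₀ hs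
    hcover hsep ht₁ μ
  set A : ℝ := (μ (closedBall 0 1)).toReal with hA
  have hfin : μ (closedBall 0 1) ≠ ⊤ := (isCompact_closedBall 0 1).measure_ne_top
  have hApos : 0 < A := ENNReal.toReal_pos
    (measure_closedBall_pos μ 0 one_pos).ne' hfin
  have hq : 0 < (q : ℝ) := by
    rw [← inv_pos, ← htq]; exact ht₀
  have hpow : ∀ k : ℕ, μ (closedBall 0 (‖t‖ ^ k)) = ENNReal.ofReal (A * ‖t‖ ^ k) := by
    intro k
    induction k with
    | zero => simp [hA, ENNReal.ofReal_toReal hfin]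
    | succ k ih =>
      rw [hstep] at ih
      have h1 : ENNReal.ofReal (A * ‖t‖ ^ k) = q * ENNReal.ofReal (A * ‖t‖ ^ (k + 1)) := by
        rw [← ENNReal.ofReal_natCast, ← ENNReal.ofReal_mul hq.le, pow_succ, htq]
        congr 1
        field_simp
      rw [h1] at ih
      exact (ENNReal.mul_right_inj (by exact_mod_cast hq.ne') (ENNReal.natCast_ne_top q)).1 ih
  have htrans : ∀ (c : K) (R : ℝ), μ (ball c R) = μ (ball 0 R) := by
    intro c R
    rw [← measure_preimage_add μ c, preimage_add_ball, sub_self]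
  refine ⟨μ, A * ‖t‖, A * ‖t‖⁻¹, inferInstance, by positivity, by positivity, fun x R hR hR1 => ?_⟩
  obtain ⟨k, hk1, hk2⟩ := exists_nat_pow_near_of_lt_one hR hR1 ht₀ ht₁
  rw [htrans]
  constructor
  · calc ENNReal.ofReal (A * ‖t‖ * R) ≤ ENNReal.ofReal (A * ‖t‖ ^ (k + 1)) := by
          apply ENNReal.ofReal_le_ofReal
          rw [pow_succ', mul_assoc]
          gcongr
      _ = μ (closedBall 0 (‖t‖ ^ (k + 1))) := (hpow _).symm
      _ ≤ μ (ball 0 R) := measure_mono (closedBall_subset_ball hk1)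
  · calc μ (ball 0 R) ≤ μ (closedBall 0 (‖t‖ ^ k)) :=
          measure_mono (ball_subset_closedBall.trans (closedBall_subset_closedBall hk2))
      _ = ENNReal.ofReal (A * ‖t‖ ^ k) := hpow k
      _ ≤ ENNReal.ofReal (A * ‖t‖⁻¹ * R) := by
          apply ENNReal.ofReal_le_ofReal
          rw [mul_assoc]
          gcongr
          rw [le_inv_mul_iff₀ ht₀, ← pow_succ']
          exact hk1.le

theorem exists_regular_measure_of_real [MeasurableSpace K] [BorelSpace K]
    (e : K ≃+* ℝ) (he : ∀ x : K, ‖e x‖ = ‖x‖) :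
    ∃ (μ : Measure K) (a b : ℝ), SigmaFinite μ ∧ 0 < a ∧ 0 < b ∧ ∀ (x : K) (R : ℝ), 0 < R → R ≤ 1 →
      ENNReal.ofReal (a * R) ≤ μ (ball x R) ∧ μ (ball x R) ≤ ENNReal.ofReal (b * R) := by
  have hiso : Isometry e := AddMonoidHomClass.isometry_of_norm e he
  let E : K ≃ᵢ ℝ := ⟨e.toEquiv, hiso⟩
  refine ⟨(volume : Measure ℝ).map E.symm, 2, 2,
    E.symm.toHomeomorph.toMeasurableEquiv.sigmaFinite_map, by norm_num,
    by norm_num, fun x R hR _ => ?_⟩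
  have : (volume : Measure ℝ).map E.symm (ball x R) = ENNReal.ofReal (2 * R) := by
    rw [Measure.map_apply E.symm.continuous.measurable measurableSet_ball,
      IsometryEquiv.preimage_ball, Real.volume_ball]
  exact ⟨this.ge, this.le⟩

theorem IsRealOrNonarchLocalField.exists_regular_measure [MeasurableSpace K] [BorelSpace K]
    (hK : IsRealOrNonarchLocalField K) :
    ∃ (μ : Measure K) (a b : ℝ), SigmaFinite μ ∧ 0 < a ∧ 0 < b ∧ ∀ (x : K) (R : ℝ), 0 < R → R ≤ 1 →
      ENNReal.ofReal (a * R) ≤ μ (ball x R) ∧ μ (ball x R) ≤ ENNReal.ofReal (b * R) := by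
  rcases hK with ⟨e, he⟩ | h
  · exact exists_regular_measure_of_real e he
  · exact h.exists_regular_measure

theorem IsRealOrNonarchLocalField.properSpace (hK : IsRealOrNonarchLocalField K) :
    ProperSpace K := by
  rcases hK with ⟨e, he⟩ | h
  · have hiso : Isometry e := AddMonoidHomClass.isometry_of_norm e he
    let E : K ≃ᵢ ℝ := ⟨e.toEquiv, hiso⟩
    exact E.symm.isometry.antilipschitz.properSpace E.symm.continuous E.symm.surjective
  · exact h.properSpace

end LocalField

/-! ### Packing bounds in `Fin n → K` by volume comparison -/

section Packing

variable {K : Type*} [NontriviallyNormedField K]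

/-- A finite set with exactly `⌈a (R / s) ^ n⌉` points that are `s`-separated exists in every ball of
radius `R ≤ 1`, and `b (ρ / s) ^ n` bounds the number of `s`-separated points in a ball of
radius `ρ ≤ 1 / 2`. -/
structure PackingBounds (n : ℕ) (K : Type*) [NontriviallyNormedField K] (a b : ℝ) : Prop where
  pos_left : 0 < a
  pos_right : 0 < b
  exists_separated : ∀ (z : Fin n → K) (R s : ℝ), 0 < s → s ≤ R → R ≤ 1 →
    ∃ T : Finset (Fin n → K), (∀ x ∈ T, x ∈ ball z R) ∧
      (∀ x ∈ T, ∀ y ∈ T, x ≠ y → s ≤ dist x y) ∧ T.card = ⌈a * (R / s) ^ n⌉₊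
  card_le : ∀ (z : Fin n → K) (ρ s : ℝ), 0 < s → s ≤ ρ → ρ ≤ 1 / 2 →
    ∀ T : Finset (Fin n → K), (∀ x ∈ T, x ∈ closedBall z ρ) →
      (∀ x ∈ T, ∀ y ∈ T, x ≠ y → s ≤ dist x y) → (T.card : ℝ) ≤ b * (ρ / s) ^ n

theorem IsRealOrNonarchLocalField.exists_packingBounds (hK : IsRealOrNonarchLocalField K) (n : ℕ) :
    ∃ a b, PackingBounds n K a b := by
  have := hK.properSpace
  let _ : MeasurableSpace K := borel K
  have : BorelSpace K := ⟨rfl⟩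
  obtain ⟨μ, a, b, hμσ, ha, hb, hμ⟩ := hK.exists_regular_measure
  let ν : Measure (Fin n → K) := Measure.pi fun _ => μ
  have hlow : ∀ (x : Fin n → K) (R : ℝ), 0 < R → R ≤ 1 →
      ENNReal.ofReal ((a * R) ^ n) ≤ ν (ball x R) := by
    intro x R hR hR1
    rw [Measure.pi_ball _ _ hR, ENNReal.ofReal_pow (by positivity)]
    calc ENNReal.ofReal (a * R) ^ n = ∏ _i : Fin n, ENNReal.ofReal (a * R) := by simp
      _ ≤ _ := Finset.prod_le_prod' fun i _ => (hμ (x i) R hR hR1).1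
  have hup : ∀ (x : Fin n → K) (R : ℝ), 0 < R → R ≤ 1 →
      ν (ball x R) ≤ ENNReal.ofReal ((b * R) ^ n) := by
    intro x R hR hR1
    rw [Measure.pi_ball _ _ hR, ENNReal.ofReal_pow (by positivity)]
    calc _ ≤ ∏ _i : Fin n, ENNReal.ofReal (b * R) :=
          Finset.prod_le_prod' fun i _ => (hμ (x i) R hR hR1).2
      _ = _ := by simp
  refine ⟨(a / b) ^ n, (4 * b / a) ^ n, by positivity, by positivity, ?_, ?_⟩
  · intro z R s hs hsR hR1
    -- Greedy choice: below the target number, the balls of radius `s` about the chosen points have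
    -- less total volume than the large ball, so another point fits.
    have key : ∀ m : ℕ, m ≤ ⌈(a / b) ^ n * (R / s) ^ n⌉₊ → ∃ T : Finset (Fin n → K),
        (∀ x ∈ T, x ∈ ball z R) ∧ (∀ x ∈ T, ∀ y ∈ T, x ≠ y → s ≤ dist x y) ∧ T.card = m := by
      classical
      intro m
      induction m with
      | zero => exact fun _ => ⟨∅, by simp⟩
      | succ m ih =>
        intro hm
        obtain ⟨T, hTz, hTs, hTm⟩ := ih (Nat.le_of_succ_le hm)
        have hm' : (m : ℝ) < (a / b) ^ n * (R / s) ^ n := Nat.lt_ceil.1 hm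
        have hlt : ν (⋃ x ∈ T, ball x s) < ν (ball z R) := by
          calc ν (⋃ x ∈ T, ball x s) ≤ ∑ x ∈ T, ν (ball x s) := measure_biUnion_finset_le _ _
            _ ≤ ∑ _x ∈ T, ENNReal.ofReal ((b * s) ^ n) :=
              Finset.sum_le_sum fun x _ => hup x s hs (hsR.trans hR1)
            _ = ENNReal.ofReal (m * (b * s) ^ n) := by
              rw [Finset.sum_const, hTm, nsmul_eq_mul, ENNReal.ofReal_mul (by positivity),
                ENNReal.ofReal_natCast]
            _ < ENNReal.ofReal ((a * R) ^ n) := by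
              rw [ENNReal.ofReal_lt_ofReal_iff (by have := hs.trans_le hsR; positivity)]
              calc m * (b * s) ^ n < (a / b) ^ n * (R / s) ^ n * (b * s) ^ n := by gcongr
                _ = (a * R) ^ n := by
                  rw [← mul_pow, ← mul_pow]
                  congr 1
                  field_simp
            _ ≤ _ := hlow z R (hs.trans_le hsR) hR1
        obtain ⟨y, hyz, hyT⟩ : ∃ y ∈ ball z R, y ∉ ⋃ x ∈ T, ball x s := by
          by_contra! hcon
          exact absurd (measure_mono hcon) (not_le.2 hlt)
        have hyd : ∀ x ∈ T, s ≤ dist y x := by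
          intro x hx
          by_contra! hlt
          exact hyT (Set.mem_biUnion hx hlt)
        have hyn : y ∉ T := fun h => by
          have := hyd y h
          rw [dist_self] at this
          linarith
        refine ⟨insert y T, ?_, ?_, by rw [Finset.card_insert_of_notMem hyn, hTm]⟩
        · intro x hx
          rcases Finset.mem_insert.1 hx with rfl | hx
          exacts [hyz, hTz x hx]
        · intro x hx x' hx' hne
          rcases Finset.mem_insert.1 hx with rfl | hxT <;>
            rcases Finset.mem_insert.1 hx' with rfl | hxT'
          · exact absurd rfl hne
          · exact hyd x' hxT'
          · rw [dist_comm]; exact hyd x hxT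
          · exact hTs x hxT x' hxT' hne
    exact key _ le_rfl
  · intro z ρ s hs hsρ hρ T hTz hTs
    have hρ0 := hs.trans_le hsρ
    have hdisj : (T : Set (Fin n → K)).PairwiseDisjoint fun x => ball x (s / 2) := by
      intro x hx y hy hne
      exact ball_disjoint_ball (by have := hTs x hx y hy hne; linarith)
    have h1 : ENNReal.ofReal (T.card * (a * (s / 2)) ^ n) ≤ ENNReal.ofReal ((b * (2 * ρ)) ^ n) := by
      calc ENNReal.ofReal (T.card * (a * (s / 2)) ^ n)
          = ∑ _x ∈ T, ENNReal.ofReal ((a * (s / 2)) ^ n) := by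
            rw [Finset.sum_const, nsmul_eq_mul, ENNReal.ofReal_mul (by positivity),
                ENNReal.ofReal_natCast]
        _ ≤ ∑ x ∈ T, ν (ball x (s / 2)) :=
          Finset.sum_le_sum fun x _ => hlow x _ (by linarith) (by linarith)
        _ = ν (⋃ x ∈ T, ball x (s / 2)) :=
          (measure_biUnion_finset hdisj fun x _ => measurableSet_ball).symm
        _ ≤ ν (ball z (2 * ρ)) := by
          apply measure_mono
          refine Set.iUnion₂_subset fun x hx => ball_subset_ball' ?_
          have := hTz x hx
          rw [mem_closedBall] at this
          linarith
        _ ≤ _ := hup z _ (by linarith) (by linarith)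
    rw [ENNReal.ofReal_le_ofReal_iff (by positivity)] at h1
    have h2 : (4 * b / a) ^ n * (ρ / s) ^ n * (a * (s / 2)) ^ n = (b * (2 * ρ)) ^ n := by
      rw [← mul_pow, ← mul_pow]
      congr 1
      field_simp
      ring
    rw [← h2] at h1
    exact le_of_mul_le_mul_right h1 (by positivity)

end Packing

/-! ### Hausdorff dimension of the limit set of a nested construction -/

section Cantor

variable {X : Type*} [MetricSpace X]

/-- A nested construction: at level `l` there are closed balls of radius `R l`, with centres in
`S l` that are `s l`-separated; the ball with centre `c` contains the balls of the next level
with centres in `Ch l c`, and there are `N l` of them. -/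
structure IsCantorScheme (S : ℕ → Finset X) (R s : ℕ → ℝ) (N : ℕ → ℕ) (Ch : ℕ → X → Finset X) :
    Prop where
  nonempty : (S 0).Nonempty
  radius_pos : ∀ l, 0 < R l
  card_pos : ∀ l, 0 < N l
  eight_radius_le : ∀ l, 8 * R l ≤ s l
  sep_le_radius : ∀ l, s (l + 1) ≤ R l
  separated : ∀ l, ∀ c ∈ S l, ∀ c' ∈ S l, c ≠ c' → s l ≤ dist c c'
  mem_succ : ∀ l c', c' ∈ S (l + 1) ↔ ∃ c ∈ S l, c' ∈ Ch l c
  card_children : ∀ l, ∀ c ∈ S l, (Ch l c).card = N l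
  dist_add_radius_le : ∀ l, ∀ c ∈ S l, ∀ c' ∈ Ch l c, dist c' c + R (l + 1) ≤ R l

/-- The union of the balls of level `l`. -/
def levelSet (S : ℕ → Finset X) (R : ℕ → ℝ) (l : ℕ) : Set X := ⋃ c ∈ S l, closedBall c (R l)

/-- The points that lie in a ball of every level. -/
def limitSet (S : ℕ → Finset X) (R : ℕ → ℝ) : Set X := ⋂ l, levelSet S R l

variable {S : ℕ → Finset X} {R s : ℕ → ℝ} {N : ℕ → ℕ} {Ch : ℕ → X → Finset X}

theorem mem_levelSet {l : ℕ} {x : X} : x ∈ levelSet S R l ↔ ∃ c ∈ S l, dist x c ≤ R l := by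
  simp [levelSet]

theorem isClosed_levelSet (l : ℕ) : IsClosed (levelSet S R l) :=
  (S l).finite_toSet.isClosed_biUnion fun _ _ => isClosed_closedBall

theorem tendsto_measure_ball_bound {C u D : ℝ} (hu : 0 < u) :
    Tendsto (fun ρ : ℝ => ENNReal.ofReal (C * ρ ^ u)) (𝓝[>] D) (𝓝 (ENNReal.ofReal (C * D ^ u))) := by
  refine ENNReal.tendsto_ofReal (Tendsto.const_mul C ?_)
  exact ((Real.continuous_rpow_const hu.le).tendsto D).mono_left nhdsWithin_le_nhds

namespace IsCantorScheme

variable (h : IsCantorScheme S R s N Ch)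
include h

theorem sep_pos (l : ℕ) : 0 < s l := by
  linarith [h.radius_pos l, h.eight_radius_le l]

theorem radius_succ_le (l : ℕ) : R (l + 1) ≤ R l / 8 := by
  linarith [h.eight_radius_le (l + 1), h.sep_le_radius l]

theorem sep_antitone : Antitone s :=
  antitone_nat_of_succ_le fun l => by
    linarith [h.eight_radius_le l, h.sep_le_radius l, h.radius_pos l]

theorem radius_le_geometric (l : ℕ) : R l ≤ R 0 * (1 / 8) ^ l := by
  induction l with
  | zero => simp
  | succ l ih =>
    rw [pow_succ]
    linarith [h.radius_succ_le l]

theorem tendsto_radius : Tendsto R atTop (𝓝 0) := by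
  refine squeeze_zero (fun l => (h.radius_pos l).le) h.radius_le_geometric ?_
  simpa using (tendsto_pow_atTop_nhds_zero_of_lt_one (r := (1 / 8 : ℝ)) (by norm_num)
    (by norm_num)).const_mul (R 0)

theorem tendsto_sep : Tendsto s atTop (𝓝 0) := by
  rw [← tendsto_add_atTop_iff_nat 1]
  exact squeeze_zero (fun l => (h.sep_pos (l + 1)).le) h.sep_le_radius h.tendsto_radius

theorem level_nonempty (l : ℕ) : (S l).Nonempty := by
  induction l with
  | zero => exact h.nonempty
  | succ l ih =>
    obtain ⟨c, hc⟩ := ih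
    have : 0 < (Ch l c).card := by rw [h.card_children l c hc]; exact h.card_pos l
    obtain ⟨c', hc'⟩ := Finset.card_pos.1 this
    exact ⟨c', (h.mem_succ l c').2 ⟨c, hc, hc'⟩⟩

theorem level_card_pos (l : ℕ) : (0 : ℝ) < (S l).card := by
  exact_mod_cast Finset.card_pos.2 (h.level_nonempty l)

theorem eq_of_dist_le {l : ℕ} {c c' x : X} (hc : c ∈ S l) (hc' : c' ∈ S l)
    (hx : dist x c ≤ R l) (hx' : dist x c' ≤ R l) : c = c' := by
  by_contra hne
  have h1 := h.separated l c hc c' hc' hne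
  have h2 := dist_triangle_left c c' x
  linarith [h.eight_radius_le l, h.radius_pos l]

theorem card_level_succ (l : ℕ) : (S (l + 1)).card = (S l).card * N l := by
  classical
  have hS : S (l + 1) = (S l).biUnion (Ch l) := by
    ext c'
    rw [h.mem_succ, Finset.mem_biUnion]
  rw [hS, Finset.card_biUnion, Finset.sum_congr rfl (h.card_children l), Finset.sum_const,
    smul_eq_mul]
  intro c hc c' hc' hne
  rw [Function.onFun, Finset.disjoint_left]
  intro x hx hx'
  have h1 := h.dist_add_radius_le l c hc x hx
  have h2 := h.dist_add_radius_le l c' hc' x hx'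
  have h3 := h.radius_pos (l + 1)
  exact hne (h.eq_of_dist_le hc hc' (x := x) (by linarith) (by linarith))

theorem levelSet_succ_subset (l : ℕ) : levelSet S R (l + 1) ⊆ levelSet S R l := by
  intro x hx
  obtain ⟨c', hc', hxc⟩ := mem_levelSet.1 hx
  obtain ⟨c, hc, hcc⟩ := (h.mem_succ l c').1 hc'
  have := h.dist_add_radius_le l c hc c' hcc
  exact mem_levelSet.2 ⟨c, hc, by linarith [dist_triangle x c' c]⟩

theorem levelSet_antitone : Antitone (levelSet S R) :=
  antitone_nat_of_succ_le h.levelSet_succ_subset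

open Classical in
theorem card_near_succ_le (x : X) (ρ : ℝ) (l : ℕ) :
    ((S (l + 1)).filter fun c => dist c x ≤ ρ + R (l + 1)).card ≤
      ((S l).filter fun c => dist c x ≤ ρ + R l).card * N l := by
  calc ((S (l + 1)).filter fun c => dist c x ≤ ρ + R (l + 1)).card
      ≤ (((S l).filter fun c => dist c x ≤ ρ + R l).biUnion (Ch l)).card := by
        apply Finset.card_le_card
        intro c' hc'
        rw [Finset.mem_filter, h.mem_succ] at hc'
        obtain ⟨⟨c, hc, hcc⟩, hd⟩ := hc'
        have := h.dist_add_radius_le l c hc c' hcc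
        rw [Finset.mem_biUnion]
        refine ⟨c, Finset.mem_filter.2 ⟨hc, ?_⟩, hcc⟩
        linarith [dist_triangle_left c x c']
    _ ≤ _ := Finset.card_biUnion_le_card_mul _ _ _ fun c hc =>
        (h.card_children l c (Finset.mem_filter.1 hc).1).le

open Classical in
-- A bound on the proportion of balls near `x` at one level thus holds at all later levels, and so
-- for the limiting mass.
theorem card_near_div_antitone (x : X) (ρ : ℝ) :
    Antitone fun l => (((S l).filter fun c => dist c x ≤ ρ + R l).card : ℝ) / (S l).card := by
  refine antitone_nat_of_succ_le fun l => ?_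
  have hN : (0 : ℝ) < N l := by exact_mod_cast h.card_pos l
  rw [h.card_level_succ, div_le_div_iff₀ (by have := h.level_card_pos l; push_cast; positivity)
    (h.level_card_pos l)]
  have := h.card_near_succ_le x ρ l
  have h2 : (((S (l + 1)).filter fun c => dist c x ≤ ρ + R (l + 1)).card : ℝ) ≤
      ((S l).filter fun c => dist c x ≤ ρ + R l).card * N l := by exact_mod_cast this
  push_cast
  nlinarith [h.level_card_pos l]

open Classical in
theorem card_near_le_one (x : X) (ρ : ℝ) (l : ℕ) (hρ : 4 * ρ ≤ s l) :
    ((S l).filter fun c => dist c x ≤ ρ + R l).card ≤ 1 := by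
  rw [Finset.card_le_one]
  intro c hc c' hc'
  rw [Finset.mem_filter] at hc hc'
  by_contra hne
  have h1 := h.separated l c hc.1 c' hc'.1 hne
  linarith [dist_triangle_right c c' x, h.eight_radius_le l, h.radius_pos l]

theorem dimH_limitSet_le {s₀ : ℝ} (hs₀ : 0 ≤ s₀)
    (hup : ∀ u, s₀ < u → ∀ᶠ l in atTop, (S l).card * R l ^ u ≤ 1) :
    dimH (limitSet S R) ≤ ENNReal.ofReal s₀ := by
  let _ : MeasurableSpace X := borel X
  have : BorelSpace X := ⟨rfl⟩
  refine le_of_forall_gt_imp_ge_of_dense fun u' hu' => ?_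
  induction u' with
  | top => exact le_top
  | coe u =>
  have hu : s₀ < u := by
    rw [← ENNReal.ofReal_coe_nnreal] at hu'
    exact (ENNReal.ofReal_lt_ofReal_iff_of_nonneg hs₀).1 hu'
  apply dimH_le_of_hausdorffMeasure_ne_top
  have hdiam : ∀ l (c : S l), ediam (closedBall (c : X) (R l)) ≤ ENNReal.ofReal (2 * R l) := by
    intro l c
    refine Metric.ediam_le fun x hx y hy => ?_
    rw [edist_dist]
    rw [mem_closedBall] at hx hy
    exact ENNReal.ofReal_le_ofReal (by linarith [dist_triangle_right x y (c : X)])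
  have hle := Measure.hausdorffMeasure_le_liminf_sum (u : ℝ) (limitSet S R) (l := atTop)
    (ι := fun l => S l) (fun l => ENNReal.ofReal (2 * R l))
    (by simpa using ENNReal.tendsto_ofReal (h.tendsto_radius.const_mul 2))
    (fun l c => closedBall (c : X) (R l)) (Eventually.of_forall hdiam)
    (Eventually.of_forall fun l x hx => by
      obtain ⟨c, hc, hxc⟩ := mem_levelSet.1 (Set.mem_iInter.1 hx l)
      exact Set.mem_iUnion.2 ⟨⟨c, hc⟩, hxc⟩)
  refine ne_top_of_le_ne_top (b := ENNReal.ofReal (2 ^ (u : ℝ))) ENNReal.ofReal_ne_top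
    (hle.trans ?_)
  refine liminf_le_of_frequently_le' (Eventually.frequently ?_)
  filter_upwards [hup u hu] with l hl
  have hR := h.radius_pos l
  calc ∑ c : S l, ediam (closedBall (c : X) (R l)) ^ (u : ℝ)
      ≤ ∑ _c : S l, ENNReal.ofReal (2 * R l) ^ (u : ℝ) :=
        Finset.sum_le_sum fun c _ => ENNReal.rpow_le_rpow (hdiam l c) u.2
    _ = ENNReal.ofReal ((S l).card * (2 * R l) ^ (u : ℝ)) := by
      rw [Finset.sum_const, Finset.card_univ, Fintype.card_coe, nsmul_eq_mul,
        ENNReal.ofReal_rpow_of_nonneg (by positivity) u.coe_nonneg,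
        ENNReal.ofReal_mul (by positivity), ENNReal.ofReal_natCast]
    _ ≤ _ := by
      apply ENNReal.ofReal_le_ofReal
      rw [Real.mul_rpow (by norm_num) hR.le]
      have : (0 : ℝ) < 2 ^ (u : ℝ) := by positivity
      nlinarith

/-- The mass distribution on the limit set: mass is spread equally over the balls of each level. -/
theorem exists_mass_distribution [ProperSpace X] [MeasurableSpace X] [BorelSpace X] :
    ∃ μ : ProbabilityMeasure X, (μ : Measure X) (limitSet S R) = 1 ∧
      ∀ (x : X) (ρ B : ℝ) (l : ℕ), (∀ m, l ≤ m →
        (((S m : Set X) ∩ ball x ρ).ncard : ℝ) ≤ B * (S m).card) →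
        (μ : Measure X) (ball x ρ) ≤ ENNReal.ofReal B := by
  classical
  let μs : ℕ → ProbabilityMeasure X := fun m =>
    ⟨(PMF.uniformOfFinset (S m) (h.level_nonempty m)).toMeasure, inferInstance⟩
  have hμs : ∀ m (A : Set X), MeasurableSet A → (μs m : Measure X) A =
      ((S m).filter fun c => c ∈ A).card / (S m).card := fun m A hA =>
    PMF.toMeasure_uniformOfFinset_apply (h.level_nonempty m) A hA
  have hcard0 : ∀ m, ((S m).card : ENNReal) ≠ 0 := fun m => by
    have := h.level_card_pos m
    exact_mod_cast this.ne'
  have hlev : ∀ l m, l ≤ m → (μs m : Measure X) (levelSet S R l) = 1 := by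
    intro l m hlm
    rw [hμs m _ (isClosed_levelSet l).measurableSet, Finset.filter_true_of_mem,
      ENNReal.div_self (hcard0 m) (ENNReal.natCast_ne_top _)]
    intro c hc
    exact h.levelSet_antitone hlm
      (mem_levelSet.2 ⟨c, hc, by rw [dist_self]; exact (h.radius_pos m).le⟩)
  have hcpt : IsCompact (levelSet S R 0) :=
    (S 0).isCompact_biUnion fun c _ => isCompact_closedBall c (R 0)
  have htight : IsTightMeasureSet {((μ : ProbabilityMeasure X) : Measure X) | μ ∈ Set.range μs} := by
    rw [isTightMeasureSet_iff_exists_isCompact_measure_compl_le]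
    intro ε hε
    refine ⟨levelSet S R 0, hcpt, ?_⟩
    rintro _ ⟨_, ⟨m, rfl⟩, rfl⟩
    rw [prob_compl_eq_one_sub hcpt.measurableSet, hlev 0 m (Nat.zero_le m)]
    simp
  -- The uniform measures on the centres all live on the compact level 0, so they are tight; a limit
  -- along an ultrafilter finer than `atTop` takes the place of a convergent subsequence.
  obtain ⟨μ, -, hμ⟩ := (isCompact_closure_of_isTightMeasureSet htight).ultrafilter_le_nhds
    ((Ultrafilter.of (atTop : Filter ℕ)).map μs) (by
      rw [le_principal_iff, Ultrafilter.coe_map]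
      exact Filter.mem_map.2 (Filter.univ_mem' fun m => subset_closure ⟨m, rfl⟩))
  have hof : ((Ultrafilter.of (atTop : Filter ℕ) : Ultrafilter ℕ) : Filter ℕ) ≤ atTop :=
    Ultrafilter.of_le atTop
  have hlim : Tendsto μs (Ultrafilter.of (atTop : Filter ℕ) : Ultrafilter ℕ) (𝓝 μ) := hμ
  refine ⟨μ, ?_, ?_⟩
  · have h1 : ∀ l, (μ : Measure X) (levelSet S R l) = 1 := by
      intro l
      refine le_antisymm prob_le_one ?_
      refine le_trans ?_ (ProbabilityMeasure.limsup_measure_closed_le_of_tendsto hlim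
        (isClosed_levelSet (S := S) (R := R) l))
      refine le_limsup_of_frequently_le' (Eventually.frequently ?_)
      exact hof ((eventually_ge_atTop l).mono fun m hm => (hlev l m hm).ge)
    have hmeas : MeasurableSet (limitSet S R) :=
      MeasurableSet.iInter fun l => (isClosed_levelSet l).measurableSet
    rw [← prob_compl_eq_zero_iff hmeas, limitSet, Set.compl_iInter, measure_iUnion_null_iff]
    intro l
    rw [prob_compl_eq_zero_iff (isClosed_levelSet l).measurableSet, h1]
  · intro x ρ B l hB
    refine (ProbabilityMeasure.le_liminf_measure_open_of_tendsto hlim isOpen_ball).trans ?_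
    refine liminf_le_of_frequently_le' (Eventually.frequently ?_)
    refine hof ((eventually_ge_atTop l).mono fun m hm => ?_)
    have h2 := hB m hm
    have h3 : ((S m : Set X) ∩ ball x ρ).ncard = ((S m).filter fun c => c ∈ ball x ρ).card := by
      rw [← Set.ncard_coe_finset]
      congr 1
      ext c
      simp
    rw [h3] at h2
    rw [hμs m _ measurableSet_ball]
    refine ENNReal.div_le_of_le_mul ?_
    rw [← ENNReal.ofReal_natCast, ← ENNReal.ofReal_natCast (S m).card,
      ← ENNReal.ofReal_mul' (by positivity)]
    exact ENNReal.ofReal_le_ofReal h2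

/-- Mass distribution principle: a set of small diameter `D` lies in the ball of any radius `ρ > D`
about each of its points, so letting `ρ` decrease to `D` bounds its mass by `C * D ^ u`, also when
`D = 0`. -/
theorem le_dimH_limitSet_of_ball_le [ProperSpace X] {u C r₀ : ℝ} (hu : 0 < u) (hC : 0 < C)
    (hr₀ : 0 < r₀)
    (hball : ∀ (x : X) (ρ : ℝ), 0 < ρ → ρ < r₀ → ∃ l, ∀ m, l ≤ m →
      (((S m : Set X) ∩ ball x ρ).ncard : ℝ) ≤ C * ρ ^ u * (S m).card) :
    ENNReal.ofReal u ≤ dimH (limitSet S R) := by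
  let _ : MeasurableSpace X := borel X
  have : BorelSpace X := ⟨rfl⟩
  obtain ⟨μ, hμ1, hμ⟩ := h.exists_mass_distribution
  have hball' : ∀ (x : X) (ρ : ℝ), 0 < ρ → ρ < r₀ →
      (μ : Measure X) (ball x ρ) ≤ ENNReal.ofReal (C * ρ ^ u) := by
    intro x ρ h0 h1
    obtain ⟨l, hl⟩ := hball x ρ h0 h1
    exact hμ x ρ _ l hl
  have hle : (ENNReal.ofReal C⁻¹) • (μ : Measure X) ≤ μH[u] := by
    refine Measure.le_hausdorffMeasure u _ (ENNReal.ofReal (r₀ / 2))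
      (by simpa using hr₀) fun A hA => ?_
    rcases A.eq_empty_or_nonempty with rfl | ⟨x, hx⟩
    · simp
    have hfin : ediam A ≠ ⊤ := ne_top_of_le_ne_top ENNReal.ofReal_ne_top hA
    set D := (ediam A).toReal with hD
    have hAD : ediam A = ENNReal.ofReal D := (ENNReal.ofReal_toReal hfin).symm
    have hD0 : 0 ≤ D := ENNReal.toReal_nonneg
    have hDr : D < r₀ := by
      have := ENNReal.toReal_le_of_le_ofReal (by positivity) hA
      linarith
    have hμA : (μ : Measure X) A ≤ ENNReal.ofReal (C * D ^ u) := by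
      refine ge_of_tendsto (tendsto_measure_ball_bound (C := C) hu (D := D)) ?_
      filter_upwards [Ioo_mem_nhdsGT hDr] with ρ hρ
      refine le_trans (measure_mono fun y hy => ?_) (hball' x ρ (hD0.trans_lt hρ.1) hρ.2)
      have h1 : edist y x ≤ ENNReal.ofReal D := hAD ▸ Metric.edist_le_ediam_of_mem hy hx
      rw [edist_dist, ENNReal.ofReal_le_ofReal_iff hD0] at h1
      exact mem_ball.2 (h1.trans_lt hρ.1)
    rw [Measure.smul_apply, smul_eq_mul, hAD, ENNReal.ofReal_rpow_of_nonneg hD0 hu.le]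
    calc ENNReal.ofReal C⁻¹ * (μ : Measure X) A
        ≤ ENNReal.ofReal C⁻¹ * ENNReal.ofReal (C * D ^ u) := by gcongr
      _ = ENNReal.ofReal (D ^ u) := by
        rw [← ENNReal.ofReal_mul (by positivity)]
        congr 1
        field_simp
  have hne : μH[((⟨u, hu.le⟩ : NNReal) : ℝ)] (limitSet S R) ≠ 0 := by
    have h1 := hle (limitSet S R)
    rw [Measure.smul_apply, hμ1, smul_eq_mul, mul_one] at h1
    exact ((ENNReal.ofReal_pos.2 (inv_pos.2 hC)).trans_le h1).ne'
  have := le_dimH_of_hausdorffMeasure_ne_zero hne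
  rwa [ENNReal.ofReal, Real.toNNReal_of_nonneg hu.le]

end IsCantorScheme

/-- For `s (k + 1) < 4 * ρ ≤ s k`, a ball of radius `ρ` is near at most one ball of level `k`, hence
near at most `N k` of level `k + 1`. Packing gives a second bound, of order `N k * (ρ / R k) ^ n`.
As `u ≤ n`, one of the two always yields `N k * (ρ / R k) ^ u` up to a constant, and `hlow` trades
`R k ^ (-u)` for the number of balls of level `k`. -/
theorem IsCantorScheme.le_dimH_limitSet {K : Type*} [NontriviallyNormedField K] [ProperSpace K]
    {n : ℕ} {S : ℕ → Finset (Fin n → K)} {R s : ℕ → ℝ} {N : ℕ → ℕ}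
    {Ch : ℕ → (Fin n → K) → Finset (Fin n → K)} (h : IsCantorScheme S R s N Ch) {a b a' s₀ : ℝ}
    (hP : PackingBounds n K a b) (ha' : 0 < a') (hs₀ : s₀ ≤ n)
    (hN : ∀ l, a' * (R l / s (l + 1)) ^ n ≤ N l)
    (hlow : ∀ u, 0 < u → u < s₀ → ∀ᶠ l in atTop, 1 ≤ (S l).card * R l ^ u) :
    ENNReal.ofReal s₀ ≤ dimH (limitSet S R) := by
  classical
  have key : ∀ u, 0 < u → u < s₀ → ENNReal.ofReal u ≤ dimH (limitSet S R) := by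
    intro u hu hus
    obtain ⟨l₀, hl₀⟩ := eventually_atTop.1 (hlow u hu hus)
    -- The value 1 serves the trivial count `N k`, and `b / a'` the packing count.
    set A : ℝ := max 1 (b / a') with hA
    have hA1 : 1 ≤ A := le_max_left _ _
    have hA2 : b ≤ A * a' := by
      rw [← div_le_iff₀ ha']; exact le_max_right _ _
    refine h.le_dimH_limitSet_of_ball_le (u := u) (C := A * 4 ^ u)
      (r₀ := min (s l₀ / 4) (1 / 8)) hu (by positivity)
      (lt_min (by linarith [h.sep_pos l₀]) (by norm_num)) ?_
    intro x ρ hρ hρr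
    have hρ1 : 4 * ρ < s l₀ := by have := hρr.trans_le (min_le_left _ _); linarith
    have hρ2 : 4 * ρ < 1 / 2 := by have := hρr.trans_le (min_le_right _ _); linarith
    obtain ⟨k, hk₀, hk1, hk2⟩ : ∃ k, l₀ ≤ k ∧ s (k + 1) < 4 * ρ ∧ 4 * ρ ≤ s k := by
      have hex : ∃ k, s k < 4 * ρ :=
        (h.tendsto_sep.eventually (gt_mem_nhds (by positivity : (0 : ℝ) < 4 * ρ))).exists
      have hlt : l₀ < Nat.find hex := by
        by_contra! hle
        have := h.sep_antitone hle
        linarith [Nat.find_spec hex]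
      obtain ⟨k, hk⟩ := Nat.exists_eq_succ_of_ne_zero (Nat.ne_zero_of_lt hlt)
      refine ⟨k, by omega, ?_, ?_⟩
      · have := Nat.find_spec hex
        rwa [hk] at this
      · exact not_lt.1 (Nat.find_min hex (by omega))
    refine ⟨k + 1, fun m hm => ?_⟩
    have hR := h.radius_pos k
    have hN0 : (0 : ℝ) < N k := by exact_mod_cast h.card_pos k
    have hS0 := h.level_card_pos k
    set Q := ((S (k + 1)).filter fun c => dist c x ≤ ρ + R (k + 1)).card with hQ
    have hQ1 : (Q : ℝ) ≤ N k := by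
      have h1 := h.card_near_succ_le x ρ k
      have h2 := h.card_near_le_one x ρ k hk2
      have : Q ≤ N k := h1.trans (by simpa using Nat.mul_le_mul_right (N k) h2)
      exact_mod_cast this
    have hQ2 : (Q : ℝ) ≤ b * (4 * ρ / s (k + 1)) ^ n := by
      refine hP.card_le x (4 * ρ) (s (k + 1)) (h.sep_pos _) hk1.le hρ2.le _ ?_ ?_
      · intro c hc
        rw [Finset.mem_filter] at hc
        rw [mem_closedBall]
        linarith [hc.2, h.eight_radius_le (k + 1)]
      · intro c hc c' hc' hne
        exact h.separated _ c (Finset.mem_filter.1 hc).1 c' (Finset.mem_filter.1 hc').1 hne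
    have hw0 : 0 < 4 * ρ / R k := by positivity
    have hQ3 : (Q : ℝ) ≤ N k * (A * (4 * ρ / R k) ^ u) := by
      rcases le_total 1 (4 * ρ / R k) with hw | hw
      · have h1 : 1 ≤ (4 * ρ / R k) ^ u := Real.one_le_rpow hw hu.le
        calc (Q : ℝ) ≤ N k * (1 * 1) := by simpa using hQ1
          _ ≤ _ := by gcongr
      · have h1 : (4 * ρ / R k) ^ n ≤ (4 * ρ / R k) ^ u := by
          rw [← Real.rpow_natCast]
          exact Real.rpow_le_rpow_of_exponent_ge hw0 hw (hus.le.trans hs₀)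
        have hs' := h.sep_pos (k + 1)
        calc (Q : ℝ) ≤ b * (4 * ρ / s (k + 1)) ^ n := hQ2
          _ ≤ A * a' * (4 * ρ / s (k + 1)) ^ n := by gcongr
          _ = (a' * (R k / s (k + 1)) ^ n) * (A * (4 * ρ / R k) ^ n) := by
            rw [div_pow, div_pow, div_pow]
            field_simp
          _ ≤ N k * (A * (4 * ρ / R k) ^ u) := by
            gcongr
            exact hN k
    have hmono := h.card_near_div_antitone x ρ hm
    have hSm := h.level_card_pos m
    simp only at hmono
    rw [div_le_iff₀ hSm] at hmono
    have hncard : (((S m : Set (Fin n → K)) ∩ ball x ρ).ncard : ℝ) ≤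
        ((S m).filter fun c => dist c x ≤ ρ + R m).card := by
      rw [← Set.ncard_coe_finset]
      exact_mod_cast Set.ncard_le_ncard (fun c hc => by
        rw [Finset.mem_coe, Finset.mem_filter]
        have := mem_ball.1 hc.2
        exact ⟨hc.1, by linarith [h.radius_pos m]⟩) (Finset.finite_toSet _)
    refine hncard.trans (hmono.trans (mul_le_mul_of_nonneg_right ?_ hSm.le))
    rw [h.card_level_succ, div_le_iff₀ (by push_cast; positivity)]
    refine hQ3.trans ?_
    have h1 := hl₀ k hk₀
    rw [Real.div_rpow (by positivity) hR.le, Real.mul_rpow (by norm_num) hρ.le]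
    push_cast
    have hRu : 0 < R k ^ u := Real.rpow_pos_of_pos hR u
    calc N k * (A * (4 ^ u * ρ ^ u / R k ^ u)) = (A * 4 ^ u * ρ ^ u * N k) * (1 / R k ^ u) := by ring
      _ ≤ (A * 4 ^ u * ρ ^ u * N k) * (S k).card := by
        gcongr
        rw [div_le_iff₀ hRu]
        exact h1
      _ = _ := by ring
  refine le_of_forall_lt_imp_le_of_dense fun u' hu' => ?_
  rcases eq_or_ne u' 0 with rfl | hne
  · exact bot_le
  have hfin : u' ≠ ⊤ := (hu'.trans_le le_top).ne
  have hpos : 0 < u'.toReal := ENNReal.toReal_pos hne hfin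
  rw [← ENNReal.ofReal_toReal hfin] at hu' ⊢
  exact key _ hpos (ENNReal.ofReal_lt_ofReal_iff'.1 hu').1

end Cantor

/-! ### Comparison of powers of a small scale `t` -/

section Asymptotics

theorem tendsto_rpow_nhdsGT_zero {x : ℝ} (hx : 0 < x) :
    Tendsto (fun t : ℝ => t ^ x) (𝓝[>] 0) (𝓝 0) := by
  have h := ((Real.continuous_rpow_const hx.le).tendsto 0).mono_left
    (nhdsWithin_le_nhds (s := Set.Ioi (0 : ℝ)))
  rwa [Real.zero_rpow hx.ne'] at h

theorem eventually_mul_rpow_lt {A B x y : ℝ} (hB : 0 < B) (hxy : y < x) :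
    ∀ᶠ t : ℝ in 𝓝[>] 0, A * t ^ x < B * t ^ y := by
  have h : Tendsto (fun t : ℝ => A * t ^ (x - y)) (𝓝[>] 0) (𝓝 0) := by
    simpa using (tendsto_rpow_nhdsGT_zero (sub_pos.2 hxy)).const_mul A
  filter_upwards [h.eventually (gt_mem_nhds hB), self_mem_nhdsWithin] with t ht ht0
  have ht0 : 0 < t := ht0
  calc A * t ^ x = A * t ^ (x - y) * t ^ y := by
        rw [mul_assoc, ← Real.rpow_add ht0, sub_add_cancel]
    _ < B * t ^ y := by
      have := Real.rpow_pos_of_pos ht0 y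
      gcongr

theorem eventually_mul_rpow_lt_const {A B x : ℝ} (hB : 0 < B) (hx : 0 < x) :
    ∀ᶠ t : ℝ in 𝓝[>] 0, A * t ^ x < B := by
  simpa using eventually_mul_rpow_lt (A := A) hB hx

theorem tendsto_pow_nhdsGT_zero {r : ℝ} (hr₀ : 0 < r) (hr₁ : r < 1) :
    Tendsto (fun j : ℕ => r ^ j) atTop (𝓝[>] 0) :=
  tendsto_nhdsWithin_iff.2 ⟨tendsto_pow_atTop_nhds_zero_of_lt_one hr₀.le hr₁,
    Eventually.of_forall fun j => pow_pos hr₀ j⟩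

/-- Numbers `⌈(G t ^ α)⁻¹⌉` of pieces of size `t ^ β` have growth exponent `n α / β`. -/
theorem eventually_ceil_mul_rpow {n : ℕ} {α β h η G B B' M : ℝ}
    (hβ : 0 < β) (hη : 0 < η) (hηh : η < h) (hlow : β * (h - η) < n * α)
    (hup : n * α < β * (h + η)) (hG : 0 < G) (hB' : 0 < B') (hM : 0 < M) :
    ∀ᶠ t : ℝ in 𝓝[>] 0, ∀ R' : ℝ, B' * t ^ β ≤ R' → R' ≤ B * t ^ β →
      1 ≤ (⌈G * (1 / t ^ α) ^ n⌉₊ : ℝ) * R' ^ (h - η) ∧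
        M * ⌈G * (1 / t ^ α) ^ n⌉₊ * R' ^ (h + η) ≤ 1 := by
  have e1 := eventually_mul_rpow_lt (A := 1) (B := G * B' ^ (h - η)) (by positivity) hlow
  have e2 := eventually_mul_rpow_lt (A := M * (G * B ^ (h + η)) * 2) one_pos hup
  have hnα : 0 < n * α := lt_trans (mul_pos hβ (by linarith)) hlow
  have e3 := eventually_mul_rpow_lt_const (A := 1) hG hnα
  filter_upwards [e1, e2, e3, self_mem_nhdsWithin] with t h1 h2 h3 ht R' hR'1 hR'2
  have ht : 0 < t := ht
  have htβ := Real.rpow_pos_of_pos ht β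
  have hB : 0 < B := by
    have : 0 < B * t ^ β := (mul_pos hB' htβ).trans_le (hR'1.trans hR'2)
    exact pos_of_mul_pos_left this htβ.le
  have hR' : 0 < R' := (mul_pos hB' htβ).trans_le hR'1
  set Y := t ^ (n * α) with hY
  have hY0 : 0 < Y := Real.rpow_pos_of_pos ht _
  have hYe : G * (1 / t ^ α) ^ n = G / Y := by
    rw [hY, mul_comm (n : ℝ) α, Real.rpow_mul ht.le, Real.rpow_natCast, one_div, inv_pow,
      div_eq_mul_inv]
  rw [hYe]
  have hN1 : G / Y ≤ ⌈G / Y⌉₊ := Nat.le_ceil _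
  have hN2 : (⌈G / Y⌉₊ : ℝ) ≤ 2 * (G / Y) := by
    have h4 := (Nat.ceil_lt_add_one (div_pos hG hY0).le).le
    have h5 : 1 ≤ G / Y := by
      rw [le_div_iff₀ hY0]; exact h3.le
    linarith
  rw [one_mul] at h1 h2
  constructor
  · have h4 : B' ^ (h - η) * t ^ (β * (h - η)) ≤ R' ^ (h - η) := by
      rw [Real.rpow_mul ht.le, ← Real.mul_rpow hB'.le htβ.le]
      exact Real.rpow_le_rpow (by positivity) hR'1 (by linarith)
    calc (1 : ℝ) ≤ G / Y * (B' ^ (h - η) * t ^ (β * (h - η))) := by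
          rw [div_mul_eq_mul_div, le_div_iff₀ hY0]
          linarith
      _ ≤ _ := by gcongr
  · have h4 : R' ^ (h + η) ≤ B ^ (h + η) * t ^ (β * (h + η)) := by
      rw [Real.rpow_mul ht.le, ← Real.mul_rpow hB.le htβ.le]
      exact Real.rpow_le_rpow hR'.le hR'2 (by linarith)
    calc M * ⌈G / Y⌉₊ * R' ^ (h + η)
        ≤ M * (2 * (G / Y)) * (B ^ (h + η) * t ^ (β * (h + η))) := by gcongr
      _ = M * (G * B ^ (h + η)) * 2 * t ^ (β * (h + η)) / Y := by ring
      _ ≤ 1 := by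
        rw [div_le_one hY0]
        exact h2.le

end Asymptotics

/-! ### One step of the construction, at a given scale -/

section Step

variable {K : Type*} [NontriviallyNormedField K] {n : ℕ}

/-- Finitely many separated balls of radius `R` inside the ball `ball x₀ ρ`. -/
structure IsLevel (x₀ : Fin n → K) (ρ : ℝ) (S : Finset (Fin n → K)) (R s : ℝ) : Prop where
  nonempty : S.Nonempty
  radius_pos : 0 < R
  radius_le : R ≤ 1 / 2
  eight_radius_le : 8 * R ≤ s
  separated : ∀ c ∈ S, ∀ c' ∈ S, c ≠ c' → s ≤ dist c c'
  dist_add_radius_lt : ∀ c ∈ S, dist c x₀ + R < ρ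

/-- One step of the nested construction, with `N` balls of radius `R'` in each ball of
radius `R`. -/
structure IsStep (a : ℝ) (S : Finset (Fin n → K)) (R : ℝ) (S' : Finset (Fin n → K))
    (R' s' : ℝ) (N : ℕ) (Ch : (Fin n → K) → Finset (Fin n → K)) : Prop where
  card_pos : 0 < N
  sep_le_radius : s' ≤ R
  mem_succ : ∀ c', c' ∈ S' ↔ ∃ c ∈ S, c' ∈ Ch c
  card_children : ∀ c ∈ S, (Ch c).card = N
  dist_add_radius_le : ∀ c ∈ S, ∀ c' ∈ Ch c, dist c' c + R' ≤ R
  le_card : a * (R / s') ^ n ≤ N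

/-- Points at mutual distance `8 * κ` in the half-size ball are moved by at most `κ` to landmarks,
and so stay `4 * κ` apart. Children of different balls are separated because the parent balls are
far apart. -/
theorem exists_children {a b : ℝ} (hP : PackingBounds n K a b) {x₀ : Fin n → K} {ρ : ℝ}
    {S : Finset (Fin n → K)} {R s : ℝ} (hS : IsLevel x₀ ρ S R s) {κ ω R' : ℝ} (hκ : 0 < κ)
    (hκR : 16 * κ ≤ R) (hωκ : 2 * ω ≤ κ) (hR'₀ : 0 < R') (hR'ω : R' ≤ ω)
    (LM : Set (Fin n → K)) (hLM : ∀ x, dist x x₀ < ρ → ∃ w ∈ LM, dist w x ≤ κ)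
    (U : Set (Fin n → K)) (e : Fin n → K) (he : ‖e‖ ≤ ω) :
    ∃ S' Ch, IsLevel x₀ ρ S' R' (4 * κ) ∧
      IsStep (a / 4 ^ n) S R S' R' (4 * κ) ⌈a * (R / (16 * κ)) ^ n⌉₊ Ch ∧
      ∀ c ∈ S, ∀ c' ∈ Ch c, ∃ w ∈ LM, dist w c ≤ R ∧
        (c ∈ U → c' = w + e) ∧ (c ∉ U → c' = w) := by
  classical
  have hR := hS.radius_pos
  have hω : 0 < ω := hR'₀.trans_le hR'ω
  have hpack : ∀ c : Fin n → K, ∃ T : Finset (Fin n → K), (∀ x ∈ T, x ∈ ball c (R / 2)) ∧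
      (∀ x ∈ T, ∀ y ∈ T, x ≠ y → 8 * κ ≤ dist x y) ∧
      T.card = ⌈a * ((R / 2) / (8 * κ)) ^ n⌉₊ := fun c =>
    hP.exists_separated c (R / 2) (8 * κ) (by linarith) (by linarith) (by linarith [hS.radius_le])
  choose T hTball hTsep hTcard using hpack
  have hratio : R / 2 / (8 * κ) = R / (16 * κ) := by field_simp; norm_num
  rw [hratio] at hTcard
  have hLM' : ∀ x : Fin n → K, ∃ w, dist x x₀ < ρ → w ∈ LM ∧ dist w x ≤ κ := by
    intro x
    by_cases hx : dist x x₀ < ρ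
    · obtain ⟨w, hw⟩ := hLM x hx
      exact ⟨w, fun _ => hw⟩
    · exact ⟨x, fun h => absurd h hx⟩
  choose w hw using hLM'
  -- The shift depends only on the parent, so it cancels in distances between siblings.
  let sh : (Fin n → K) → (Fin n → K) := fun c => if c ∈ U then e else 0
  have hsh : ∀ c, ‖sh c‖ ≤ ω := by
    intro c
    by_cases hc : c ∈ U
    · simpa [sh, hc] using he
    · simpa [sh, hc] using hω.le
  let Ch : (Fin n → K) → Finset (Fin n → K) := fun c => (T c).image fun x => w x + sh c
  have hTρ : ∀ c ∈ S, ∀ x ∈ T c, dist x x₀ < ρ := by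
    intro c hc x hx
    have h1 := mem_ball.1 (hTball c x hx)
    have h2 := hS.dist_add_radius_lt c hc
    linarith [dist_triangle x c x₀]
  have hwc : ∀ c ∈ S, ∀ x ∈ T c, dist (w x) c ≤ R / 2 + κ := by
    intro c hc x hx
    have h1 := mem_ball.1 (hTball c x hx)
    have h2 := (hw x (hTρ c hc x hx)).2
    linarith [dist_triangle (w x) x c]
  have hchild : ∀ c ∈ S, ∀ x ∈ T c, dist (w x + sh c) c + R' ≤ R := by
    intro c hc x hx
    have h1 := hwc c hc x hx
    have h2 : dist (w x + sh c) (w x) ≤ ω := by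
      rw [dist_eq_norm, add_sub_cancel_left]; exact hsh c
    linarith [dist_triangle (w x + sh c) (w x) c]
  have hsame : ∀ c ∈ S, ∀ x ∈ T c, ∀ y ∈ T c, x ≠ y → 4 * κ ≤ dist (w x + sh c) (w y + sh c) := by
    intro c hc x hx y hy hne
    rw [dist_add_right]
    have h1 := hTsep c x hx y hy hne
    have h2 := (hw x (hTρ c hc x hx)).2
    have h3 := (hw y (hTρ c hc y hy)).2
    have h4 := dist_triangle4_left (w x) (w y) x y
    linarith
  have hdiff : ∀ c ∈ S, ∀ c' ∈ S, c ≠ c' → ∀ x ∈ Ch c, ∀ y ∈ Ch c', 4 * κ ≤ dist x y := by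
    intro c hc c' hc' hne x hx y hy
    obtain ⟨x, hxT, rfl⟩ := Finset.mem_image.1 hx
    obtain ⟨y, hyT, rfl⟩ := Finset.mem_image.1 hy
    have h1 := hS.separated c hc c' hc' hne
    have h2 := hchild c hc x hxT
    have h3 := hchild c' hc' y hyT
    have h4 := dist_triangle4_left (w x + sh c) (w y + sh c') c c'
    linarith [hS.eight_radius_le]
  refine ⟨S.biUnion Ch, Ch, ⟨?_, hR'₀, ?_, ?_, ?_, ?_⟩, ⟨?_, ?_, ?_, ?_, ?_, ?_⟩, ?_⟩
  · obtain ⟨c, hc⟩ := hS.nonempty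
    have h1 : 0 < (T c).card := by
      rw [hTcard]
      have := hP.pos_left
      exact Nat.ceil_pos.2 (by positivity)
    obtain ⟨x, hx⟩ := Finset.card_pos.1 h1
    exact ⟨_, Finset.mem_biUnion.2 ⟨c, hc, Finset.mem_image_of_mem _ hx⟩⟩
  · linarith [hS.radius_le]
  · linarith
  · intro x hx y hy hne
    obtain ⟨c, hc, hxc⟩ := Finset.mem_biUnion.1 hx
    obtain ⟨c', hc', hyc⟩ := Finset.mem_biUnion.1 hy
    by_cases hcc : c = c'
    · subst hcc
      obtain ⟨x, hxT, rfl⟩ := Finset.mem_image.1 hxc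
      obtain ⟨y, hyT, rfl⟩ := Finset.mem_image.1 hyc
      exact hsame c hc x hxT y hyT fun h => hne (by rw [h])
    · exact hdiff c hc c' hc' hcc x hxc y hyc
  · intro x hx
    obtain ⟨c, hc, hxc⟩ := Finset.mem_biUnion.1 hx
    obtain ⟨x, hxT, rfl⟩ := Finset.mem_image.1 hxc
    have h1 := hchild c hc x hxT
    linarith [hS.dist_add_radius_lt c hc, dist_triangle (w x + sh c) c x₀]
  · have := hP.pos_left
    exact Nat.ceil_pos.2 (by positivity)
  · linarith
  · intro c'
    exact Finset.mem_biUnion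
  · intro c hc
    rw [← hTcard c]
    refine Finset.card_image_of_injOn fun x hx y hy hxy => ?_
    by_contra hne
    have := hsame c hc x hx y hy hne
    rw [hxy, dist_self] at this
    linarith
  · intro c hc c' hc'
    obtain ⟨x, hxT, rfl⟩ := Finset.mem_image.1 hc'
    exact hchild c hc x hxT
  · refine le_trans (le_of_eq ?_) (Nat.le_ceil _)
    rw [div_pow, div_pow, mul_pow, mul_pow, show (16 : ℝ) = 4 * 4 by norm_num, mul_pow]
    field_simp
  · intro c hc c' hc'
    obtain ⟨x, hxT, rfl⟩ := Finset.mem_image.1 hc'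
    refine ⟨w x, (hw x (hTρ c hc x hxT)).1, by linarith [hwc c hc x hxT], fun hU => ?_, fun hU => ?_⟩
    · simp [sh, hU]
    · simp [sh, hU]

/-- `S` and `R` are fixed before `t` tends to 0, so they enter only as constants, which any gap
between exponents absorbs. The landmarks and the shift depend on the scale and are therefore
quantified after `t`. -/
theorem eventually_exists_step {a b : ℝ} (hP : PackingBounds n K a b) {x₀ : Fin n → K} {ρ : ℝ}
    {S : Finset (Fin n → K)} {R s : ℝ} (hS : IsLevel x₀ ρ S R s) {α β h η B B' C : ℝ} (hα : 0 < α)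
    (hαβ : α < β) (hη : 0 < η) (hηh : η < h) (hlow : β * (h - η) < n * α)
    (hup : n * α < β * (h + η)) (hB' : 0 < B') (hC : 0 < C) :
    ∀ᶠ t : ℝ in 𝓝[>] 0, ∀ R' : ℝ, B' * t ^ β ≤ R' → R' ≤ B * t ^ β →
      ∀ (LM : Set (Fin n → K)), (∀ x, dist x x₀ < ρ → ∃ w ∈ LM, dist w x ≤ C * t ^ α) →
      ∀ (U : Set (Fin n → K)) (e : Fin n → K), ‖e‖ ≤ B * t ^ β →
      ∃ S' s' N Ch, IsLevel x₀ ρ S' R' s' ∧ IsStep (a / 4 ^ n) S R S' R' s' N Ch ∧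
        1 ≤ N * R' ^ (h - η) ∧ S.card * N * R' ^ (h + η) ≤ 1 ∧
        ∀ c ∈ S, ∀ c' ∈ Ch c, ∃ w ∈ LM, dist w c ≤ R ∧
          (c ∈ U → c' = w + e) ∧ (c ∉ U → c' = w) := by
  have hR := hS.radius_pos
  have ha := hP.pos_left
  have hM : (0 : ℝ) < S.card := by exact_mod_cast Finset.card_pos.2 hS.nonempty
  have e1 := eventually_ceil_mul_rpow (n := n) (B := B) (G := a * (R / (16 * C)) ^ n)
    (hα.trans hαβ) hη hηh hlow hup (by positivity) hB' hM
  have e2 := eventually_mul_rpow_lt_const (A := 16 * C) hR hα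
  have e3 := eventually_mul_rpow_lt (A := 2 * B) hC hαβ
  filter_upwards [e1, e2, e3, self_mem_nhdsWithin] with t h1 h2 h3 ht R' hR'1 hR'2 LM hLM U e he
  have ht : 0 < t := ht
  have htα := Real.rpow_pos_of_pos ht α
  have htβ := Real.rpow_pos_of_pos ht β
  obtain ⟨S', Ch, hL, hSt, hch⟩ := exists_children hP hS (κ := C * t ^ α) (ω := B * t ^ β)
    (R' := R') (by positivity) (by linarith) (by linarith) ((mul_pos hB' htβ).trans_le hR'1)
    hR'2 LM hLM U e he
  have hN : a * (R / (16 * (C * t ^ α))) ^ n = a * (R / (16 * C)) ^ n * (1 / t ^ α) ^ n := by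
    rw [mul_assoc, ← mul_pow]
    congr 2
    field_simp
  rw [hN] at hSt
  obtain ⟨h4, h5⟩ := h1 R' hR'1 hR'2
  exact ⟨S', _, _, Ch, hL, hSt, h4, h5, hch⟩

end Step

/-! ### The landmark argument for nonvanishing -/

section Nonvanishing

variable {K : Type*} [NontriviallyNormedField K]

/-- On a compact set where the derivative of `g` in the direction `e` does not vanish, the variation
of `g` is bounded below and above uniformly. -/
theorem exists_uniform_variation_bounds {E : Type*} [NormedAddCommGroup E] [NormedSpace K E]
    {A : Set E} (hA : IsCompact A) {g : E → K}
    (hg : ∀ x, ∃ g' : E →L[K] K, HasStrictFDerivAt g g' x) {e : E} (he : ‖e‖ ≤ 1)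
    (hne : ∀ x ∈ A, lineDeriv K g x e ≠ 0) :
    ∃ κ L δ : ℝ, 0 < κ ∧ 0 < L ∧ 0 < δ ∧ ∀ x ∈ A, ∀ (τ : K) (u : E), ‖τ‖ ≤ δ → ‖u‖ ≤ δ →
      κ * ‖τ‖ - L * ‖u‖ ≤ ‖g (x + τ • e + u) - g x‖ ∧
        ‖g (x + τ • e + u) - g x‖ ≤ L * (‖τ‖ + ‖u‖) := by
  refine hA.induction_on (p := fun A => ∃ κ L δ : ℝ, 0 < κ ∧ 0 < L ∧ 0 < δ ∧ ∀ x ∈ A,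
      ∀ (τ : K) (u : E), ‖τ‖ ≤ δ → ‖u‖ ≤ δ →
      κ * ‖τ‖ - L * ‖u‖ ≤ ‖g (x + τ • e + u) - g x‖ ∧
        ‖g (x + τ • e + u) - g x‖ ≤ L * (‖τ‖ + ‖u‖)) ?_ ?_ ?_ ?_
  · exact ⟨1, 1, 1, one_pos, one_pos, one_pos, fun x hx => absurd hx (Set.notMem_empty x)⟩
  · rintro s t hst ⟨κ, L, δ, h1, h2, h3, h4⟩
    exact ⟨κ, L, δ, h1, h2, h3, fun x hx => h4 x (hst hx)⟩
  · rintro s t ⟨κ, L, δ, h1, h2, h3, h4⟩ ⟨κ', L', δ', h1', h2', h3', h4'⟩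
    refine ⟨min κ κ', max L L', min δ δ', lt_min h1 h1', lt_max_of_lt_left h2, lt_min h3 h3', ?_⟩
    intro x hx τ u hτ hu
    rcases hx with hx | hx
    · obtain ⟨h5, h6⟩ := h4 x hx τ u (hτ.trans (min_le_left _ _)) (hu.trans (min_le_left _ _))
      constructor
      · refine le_trans ?_ h5
        gcongr
        exacts [min_le_left _ _, le_max_left _ _]
      · refine h6.trans ?_
        gcongr
        exact le_max_left _ _
    · obtain ⟨h5, h6⟩ := h4' x hx τ u (hτ.trans (min_le_right _ _)) (hu.trans (min_le_right _ _))
      constructor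
      · refine le_trans ?_ h5
        gcongr
        exacts [min_le_right _ _, le_max_right _ _]
      · refine h6.trans ?_
        gcongr
        exact le_max_right _ _
  · intro a ha
    obtain ⟨g', hg'⟩ := hg a
    have hd : g' e ≠ 0 := by
      have := hne a ha
      rwa [(hg'.hasFDerivAt.hasLineDerivAt e).lineDeriv] at this
    -- Half of the derivative survives as the lower bound; the other half pays for the linearisation
    -- error.
    set η := ‖g' e‖ / 2 with hη
    have hη0 : 0 < η := half_pos (norm_pos_iff.2 hd)
    have hst := hg'.isLittleO.def hη0
    rw [Metric.eventually_nhds_iff] at hst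
    obtain ⟨δ, hδ, hball⟩ := hst
    refine ⟨ball a (δ / 2), mem_nhdsWithin_of_mem_nhds (ball_mem_nhds a (half_pos hδ)), η,
      ‖g'‖ + η, δ / 8, hη0, by positivity, by positivity, ?_⟩
    intro x hx τ u hτ hu
    have hτe : ‖τ • e‖ ≤ ‖τ‖ := by
      rw [norm_smul]
      exact mul_le_of_le_one_right (norm_nonneg _) he
    have hsum : ‖τ • e + u‖ ≤ ‖τ‖ + ‖u‖ := (norm_add_le _ _).trans (by linarith)
    have hdist : dist (x + τ • e + u, x) (a, a) < δ := by
      rw [mem_ball] at hx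
      rw [Prod.dist_eq]
      refine max_lt ?_ (by linarith)
      have : dist (x + τ • e + u) x = ‖τ • e + u‖ := by
        rw [dist_eq_norm]; congr 1; abel
      have h2 := dist_triangle (x + τ • e + u) x a
      linarith
    have hest := hball hdist
    simp only at hest
    have hdiff : x + τ • e + u - x = τ • e + u := by abel
    rw [hdiff] at hest
    set Δ := g (x + τ • e + u) - g x with hΔ
    have hest' : ‖Δ - g' (τ • e + u)‖ ≤ η * (‖τ‖ + ‖u‖) := hest.trans (by gcongr)
    have hlin : g' (τ • e + u) = τ * g' e + g' u := by simp
    have hgu : ‖g' u‖ ≤ ‖g'‖ * ‖u‖ := g'.le_opNorm u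
    have hge : ‖g' e‖ = 2 * η := by rw [hη]; ring
    constructor
    · have h1 : ‖τ * g' e‖ ≤ ‖Δ‖ + ‖Δ - g' (τ • e + u)‖ + ‖g' u‖ := by
        have : τ * g' e = Δ - (Δ - g' (τ • e + u)) - g' u := by rw [hlin]; ring
        rw [this]
        exact (norm_sub_le _ _).trans (add_le_add_left (norm_sub_le _ _) _)
      rw [norm_mul, hge] at h1
      linarith
    · have h1 : ‖Δ‖ ≤ ‖Δ - g' (τ • e + u)‖ + ‖g' (τ • e + u)‖ := by
        have : Δ = (Δ - g' (τ • e + u)) + g' (τ • e + u) := by ring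
        conv_lhs => rw [this]
        exact norm_add_le _ _
      have h2 : ‖g' (τ • e + u)‖ ≤ ‖g'‖ * (‖τ‖ + ‖u‖) :=
        (g'.le_opNorm _).trans (by gcongr)
      linarith

/-- Near a point where the value of `g` is close to a landmark value, moving the point by `τ` in
the direction `e` makes `g` nonzero. -/
theorem eventually_ne_zero_of_landmark {ι E : Type*} [NormedAddCommGroup E] [NormedSpace K E]
    {r γ D : ℝ} (hr₀ : 0 < r) (hr₁ : r < 1) (hγ : 0 < γ) (hD : 0 < D) {Ω : Set K}
    {G : (ι → K) → K} {ℓ₁ ℓ₂ : K → ℕ∞} {J : Set ℕ} {δ₁ : ℝ} {err : ℕ → ℝ} (hsep : Separated r γ ℓ₂)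
    (herr : err =o[atTop] fun j : ℕ => (j : ℝ))
    (happ : ∀ j ∈ J, ∀ x : ι → K, (∀ i, x i ∈ Ω) → (∀ i, ℓ₁ (x i) ≤ (j : ℕ∞)) →
      ∃ (y : K) (N : ℕ), ℓ₂ y = (N : ℕ∞) ∧ (N : ℝ) ≤ D * (j : ℝ) + err j ∧
        dist y (G x) ≤ r ^ ((γ * D + δ₁) * (j : ℝ)))
    {δ' : ℝ} (hδ' : 0 < δ') (hδδ : δ' < δ₁) {A : Set E} {g : E → K} {e : E} {κ L δ : ℝ}
    (hκ : 0 < κ) (hL : 0 < L) (hδ : 0 < δ)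
    (hvar : ∀ x ∈ A, ∀ (τ : K) (u : E), ‖τ‖ ≤ δ → ‖u‖ ≤ δ →
      κ * ‖τ‖ - L * ‖u‖ ≤ ‖g (x + τ • e + u) - g x‖ ∧
        ‖g (x + τ • e + u) - g x‖ ≤ L * (‖τ‖ + ‖u‖)) (B : ℝ) {θ : ℝ} (hθ₁ : θ ≤ 1)
    (hθκ : L * θ ≤ κ / 2) :
    ∀ᶠ j : ℕ in atTop, j ∈ J → ∀ (τ : K), (r ^ j) ^ (γ * D + δ') ≤ ‖τ‖ →
      ‖τ‖ ≤ B * (r ^ j) ^ (γ * D + δ') → ∀ x ∈ A, ∀ X : ι → K, g x = G X → (∀ i, X i ∈ Ω) →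
      (∀ i, ℓ₁ (X i) ≤ (j : ℕ∞)) → ∀ u : E, ‖u‖ ≤ θ * ‖τ‖ → g (x + τ • e + u) ≠ 0 := by
  have hβ : 0 < γ * D + δ' := by positivity
  have hrt : ∀ (x : ℝ) (j : ℕ), r ^ (x * (j : ℝ)) = (r ^ j) ^ x := fun x j => by
    rw [mul_comm, Real.rpow_mul hr₀.le, Real.rpow_natCast]
  -- Then `γ * D * ε = δ' / 4`; the term `err` is allowed another `δ' / 4`, which keeps the
  -- separation exponent at most `γ * D + δ' / 2`, below that of `‖τ‖`.
  set ε := δ' / (4 * γ * D) with hε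
  have hε0 : 0 < ε := by positivity
  obtain ⟨C, hC, hCsep⟩ := hsep ε hε0
  have htend := tendsto_pow_nhdsGT_zero hr₀ hr₁
  have e1 := htend.eventually (eventually_mul_rpow_lt_const (A := B) hδ hβ)
  have e2 := htend.eventually (eventually_mul_rpow_lt (A := 1) (half_pos hκ)
    (show γ * D + δ' < γ * D + δ₁ by linarith))
  have e3 := htend.eventually (eventually_mul_rpow_lt (A := κ / 2 + 2 * L * B) (inv_pos.2 hC)
    (show γ * D + δ' / 2 < γ * D + δ' by linarith))
  have hc : 0 < δ' / (4 * (γ * (1 + ε))) := by positivity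
  have e4 := herr.def hc
  filter_upwards [e1, e2, e3, e4] with j h1 h2 h3 h4 hj τ hτ1 hτ2 x hx X hgX hXΩ hXℓ u hu h0
  set t := r ^ j with ht
  have ht0 : 0 < t := pow_pos hr₀ j
  have htβ := Real.rpow_pos_of_pos ht0 (γ * D + δ')
  obtain ⟨y, N, hyN, hN, hyG⟩ := happ j hj X hXΩ hXℓ
  rw [← hgX, hrt, dist_eq_norm] at hyG
  have hu' : ‖u‖ ≤ ‖τ‖ := hu.trans (mul_le_of_le_one_left (norm_nonneg _) hθ₁)
  obtain ⟨hlow, hup⟩ := hvar x hx τ u (hτ2.trans h1.le) (hu'.trans (hτ2.trans h1.le))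
  rw [h0, zero_sub, norm_neg] at hlow hup
  have hLu : L * ‖u‖ ≤ κ / 2 * ‖τ‖ := by
    calc L * ‖u‖ ≤ L * (θ * ‖τ‖) := by gcongr
      _ = L * θ * ‖τ‖ := by ring
      _ ≤ _ := by gcongr
  have hgx1 : κ / 2 * t ^ (γ * D + δ') ≤ ‖g x‖ := by
    have : κ / 2 * t ^ (γ * D + δ') ≤ κ / 2 * ‖τ‖ := by gcongr
    linarith
  have hgx2 : ‖g x‖ ≤ 2 * L * B * t ^ (γ * D + δ') := by
    calc ‖g x‖ ≤ L * (‖τ‖ + ‖u‖) := hup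
      _ ≤ L * (‖τ‖ + ‖τ‖) := by gcongr
      _ = 2 * L * ‖τ‖ := by ring
      _ ≤ 2 * L * (B * t ^ (γ * D + δ')) := by gcongr
      _ = _ := by ring
  -- The value 0 would approximate `g x` better than the lower bound `hgx1` permits.
  have hy0 : y ≠ 0 := by
    rintro rfl
    rw [zero_sub, norm_neg] at hyG
    linarith
  have hy1 : C⁻¹ * r ^ (γ * (N : ℝ) * (1 + ε)) ≤ ‖y‖ := by
    by_contra! hlt
    exact hy0 (hCsep N y (by rwa [mem_ball, dist_zero_right]) hyN.le)
  have hexp : γ * (N : ℝ) * (1 + ε) ≤ (γ * D + δ' / 2) * j := by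
    have h5 : err j ≤ δ' / (4 * (γ * (1 + ε))) * j := by
      have := (le_abs_self _).trans h4
      simpa using this
    calc γ * (N : ℝ) * (1 + ε) = γ * (1 + ε) * N := by ring
      _ ≤ γ * (1 + ε) * (D * j + δ' / (4 * (γ * (1 + ε))) * j) := by
        have : (N : ℝ) ≤ D * j + δ' / (4 * (γ * (1 + ε))) * j := by linarith
        gcongr
      _ = (γ * D + γ * D * ε + δ' / 4) * j := by
        field_simp
      _ = (γ * D + δ' / 2) * j := by
        rw [hε]
        field_simp
        ring
  -- A nonzero `y` is this large, whereas `hgx2` and the approximation error force it to be of order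
  -- `t ^ (γ * D + δ')`.
  have hy2 : C⁻¹ * t ^ (γ * D + δ' / 2) ≤ ‖y‖ := by
    refine le_trans ?_ hy1
    rw [ht, ← hrt]
    have := Real.rpow_le_rpow_of_exponent_ge hr₀ hr₁.le hexp
    gcongr
  have hy3 : ‖y‖ ≤ ‖y - g x‖ + ‖g x‖ := by
    simpa using norm_add_le (y - g x) (g x)
  rw [one_mul] at h2
  linarith

end Nonvanishing

/-! ### Choice of exponents, and steps using landmarks -/

section LandmarkStep

/-- At `ε = ξ = 0` the last two inequalities hold with margin `d * γ * η`, because `d * γ * h = n *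
σ`. A whole interval of `ξ` is needed: the excess of the radius exponent over `γ * d` is fixed only
after `ξ₀`. -/
theorem exists_exponents {n : ℕ} (hn : 0 < n) {γ σ d η h : ℝ} (hσ : 0 < σ)
    (hd : σ ≤ d * γ) (hh : h = n * σ / (d * γ)) (hη : 0 < η) (hηh : η < h) :
    ∃ ε ξ₀ : ℝ, 0 < ε ∧ ε < σ ∧ 0 < ξ₀ ∧ ∀ ξ, 0 ≤ ξ → ξ ≤ ξ₀ → σ - ε < γ * d + ξ ∧
      (γ * d + ξ) * (h - η) < n * (σ - ε) ∧ n * (σ - ε) < (γ * d + ξ) * (h + η) := by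
  have hn' : (0 : ℝ) < n := by exact_mod_cast hn
  have hdγ : 0 < d * γ := hσ.trans_le hd
  have hh0 : 0 < h := hη.trans hηh
  have hmul : d * γ * h = n * σ := by
    rw [hh, mul_div_assoc', mul_div_cancel_left₀ _ hdγ.ne']
  refine ⟨min (σ / 2) (d * γ * η / (4 * n)), d * γ * η / (4 * h),
    lt_min (by positivity) (by positivity), (min_le_left _ _).trans_lt (by linarith),
    by positivity, fun ξ h0 h1 => ?_⟩
  set ε := min (σ / 2) (d * γ * η / (4 * n)) with hε
  have hε0 : 0 < ε := lt_min (by positivity) (by positivity)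
  have hε1 : n * ε ≤ d * γ * η / 4 := by
    calc n * ε ≤ n * (d * γ * η / (4 * n)) := by
          gcongr
          exact min_le_right _ _
      _ = _ := by field_simp
  have hξ : ξ * h ≤ d * γ * η / 4 := by
    calc ξ * h ≤ d * γ * η / (4 * h) * h := by gcongr
      _ = _ := by field_simp
  have hpos : 0 < d * γ * η := by positivity
  have hnε : 0 < n * ε := by positivity
  have hξη : 0 ≤ ξ * η := by positivity
  have hξh : 0 ≤ ξ * h := by positivity
  refine ⟨by linarith, ?_, ?_⟩ <;> nlinarith

variable {K : Type*} [NontriviallyNormedField K] {n : ℕ}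

/-- The values of the norm may be discrete, so the size of a shift can be prescribed only up to a
factor. -/
theorem exists_norm_mem_shell {c : K} (hc : 1 < ‖c‖) {x : ℝ} (hx : 0 < x) :
    ∃ τ : K, x ≤ ‖τ‖ ∧ ‖τ‖ ≤ ‖c‖ * x := by
  obtain ⟨τ, -, h1, h2, -⟩ := rescale_to_shell hc (ε := ‖c‖ * x) (by positivity) (one_ne_zero (α := K))
  rw [smul_eq_mul, mul_one] at h1 h2
  rw [mul_div_cancel_left₀ _ (by positivity)] at h2
  exact ⟨τ, h2, h1.le⟩

/-- A step of the construction for which no nonvanishing condition is imposed. -/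
theorem exists_step {a b : ℝ} (hP : PackingBounds n K a b) (hn : 0 < n) {x₀ : Fin n → K} {ρ : ℝ}
    {S : Finset (Fin n → K)} {R s : ℝ} (hS : IsLevel x₀ ρ S R s) {γ σ d η h : ℝ} (hσ : 0 < σ)
    (hd : σ ≤ d * γ) (hh : h = n * σ / (d * γ)) (hη : 0 < η) (hηh : η < h) :
    ∃ S' R' s' N Ch, IsLevel x₀ ρ S' R' s' ∧ IsStep (a / 4 ^ n) S R S' R' s' N Ch ∧
      1 ≤ N * R' ^ (h - η) ∧ S.card * N * R' ^ (h + η) ≤ 1 := by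
  obtain ⟨ε, ξ₀, hε, hεσ, hξ₀, hexp⟩ := exists_exponents hn hσ hd hh hη hηh
  obtain ⟨h1, h2, h3⟩ := hexp 0 le_rfl hξ₀.le
  obtain ⟨t, ht, ht0⟩ := ((eventually_exists_step hP hS (B := 1) (sub_pos.2 hεσ) h1 hη hηh h2 h3
    one_pos one_pos).and self_mem_nhdsWithin).exists
  have ht0 : 0 < t := ht0
  have htα := Real.rpow_pos_of_pos ht0 (σ - ε)
  have htβ := Real.rpow_pos_of_pos ht0 (γ * d + 0)
  obtain ⟨S', s', N, Ch, h4, h5, h6, h7, -⟩ := ht (t ^ (γ * d + 0)) (one_mul _).le (one_mul _).ge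
    Set.univ (fun x _ => ⟨x, Set.mem_univ x, by rw [dist_self]; positivity⟩) ∅ 0
    (by rw [norm_zero]; positivity)
  exact ⟨S', _, s', N, Ch, h4, h5, h6, h7⟩

/-- A step of the construction that makes `g` nonvanishing on products of balls where a partial
derivative of `g` does not vanish. -/
theorem exists_step_of_landmarks [ProperSpace K] {a b : ℝ} (hP : PackingBounds n K a b)
    (hn : 0 < n) {x₀ : Fin n → K} {ρ : ℝ} {S : Finset (Fin n → K)} {R s : ℝ}
    (hS : IsLevel x₀ ρ S R s) {r γ σ d η h : ℝ} (hr₀ : 0 < r) (hr₁ : r < 1) (hσ : 0 < σ)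
    (hγ : 0 < γ) (hd : σ ≤ d * γ) (hh : h = n * σ / (d * γ)) (hη : 0 < η) (hηh : η < h) {v : ℕ}
    {g : (Fin v → Fin n → K) → K} (hg : ∀ x, ∃ g', HasStrictFDerivAt (𝕜 := K) g g' x)
    (p : Fin v × Fin n) (U : Set (Fin n → K)) {ε : ℕ → ℝ} (hε₀ : ∀ m, 0 < ε m)
    (hε : Tendsto ε atTop (𝓝 0))
    (hL : ∀ m, ∃ (Ω : Set K) (ℓ₁ ℓ₂ : K → ℕ∞), (∀ x ∈ ball x₀ ρ, ∀ i, x i ∈ Ω) ∧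
      IsWeakApproxLandmarkPair r γ σ (d + ε m) Ω
        (fun x : Fin v × Fin n → K => g fun k i => x (k, i)) ℓ₁ ℓ₂) :
    ∃ S' R' s' N Ch, IsLevel x₀ ρ S' R' s' ∧ IsStep (a / 4 ^ n) S R S' R' s' N Ch ∧
      1 ≤ N * R' ^ (h - η) ∧ S.card * N * R' ^ (h + η) ≤ 1 ∧
      ∀ T T' : Fin v → Fin n → K, (∀ k, T k ∈ S) → (∀ k, T' k ∈ Ch (T k)) → T p.1 ∈ U →
        (∀ k, k ≠ p.1 → T k ∉ U) →
        (∀ x : Fin v → Fin n → K, (∀ k, dist (x k) (T k) ≤ R) → pderiv p g x ≠ 0) →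
        ∀ x : Fin v → Fin n → K, (∀ k, dist (x k) (T' k) ≤ R') → g x ≠ 0 := by
  have hdpos : 0 < d := pos_of_mul_pos_left (hσ.trans_le hd) hγ.le
  obtain ⟨ε₁, ξ₀, hε₁, hεσ, hξ₀, hexp⟩ := exists_exponents hn hσ hd hh hη hηh
  obtain ⟨m, hm⟩ : ∃ m, γ * ε m < ξ₀ / 2 := by
    have := (hε.const_mul γ).eventually (gt_mem_nhds (show γ * 0 < ξ₀ / 2 by linarith))
    exact this.exists
  obtain ⟨Ω, ℓ₁, ℓ₂, hBΩ, hsep, hubi, J, δ₁, err, hJ, hδ₁, herr, happ⟩ := hL m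
  set D := d + ε m with hD
  have hD0 : 0 < D := add_pos hdpos (hε₀ m)
  -- Below `δ₁` for the landmark argument; with `γ * ε m < ξ₀ / 2`, it keeps the radius exponent `γ
  -- * D + δ'` within `ξ₀` of `γ * d`.
  set δ' := min (δ₁ / 2) (ξ₀ / 2) with hδ'
  have hδ'0 : 0 < δ' := lt_min (by positivity) (by positivity)
  have hδδ : δ' < δ₁ := (min_le_left _ _).trans_lt (by linarith)
  have hβeq : γ * D + δ' = γ * d + (γ * ε m + δ') := by rw [hD]; ring
  have hξ1 : γ * ε m + δ' ≤ ξ₀ := by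
    have := min_le_right (δ₁ / 2) (ξ₀ / 2)
    linarith
  obtain ⟨hαβ, hlow, hup⟩ := hexp (γ * ε m + δ') (by have := hε₀ m; positivity) hξ1
  rw [← hβeq] at hαβ hlow hup
  obtain ⟨C, hC, hCubi⟩ := hubi ε₁ hε₁
  -- There are finitely many such products of balls, so their union is compact and the variation
  -- bounds are uniform, fixed before the scale is chosen.
  let good : Set (Fin v → Fin n → K) := {T | (∀ k, T k ∈ S) ∧
    ∀ x : Fin v → Fin n → K, (∀ k, dist (x k) (T k) ≤ R) → pderiv p g x ≠ 0}
  have hgood : good.Finite :=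
    (Set.Finite.pi' fun _ : Fin v => S.finite_toSet).subset fun T hT => hT.1
  let A : Set (Fin v → Fin n → K) := ⋃ T ∈ good, Set.univ.pi fun k => closedBall (T k) R
  have hA : IsCompact A := hgood.isCompact_biUnion fun T _ =>
    isCompact_univ_pi fun k => isCompact_closedBall _ _
  let e : Fin v → Fin n → K := Pi.single p.1 (Pi.single p.2 1)
  have he : ‖e‖ ≤ 1 := by
    simp [e, Pi.norm_single]
  have hneA : ∀ x ∈ A, lineDeriv K g x e ≠ 0 := by
    intro x hx
    obtain ⟨T, hT, hxT⟩ := Set.mem_iUnion₂.1 hx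
    exact hT.2 x fun k => mem_closedBall.1 (hxT k (Set.mem_univ k))
  obtain ⟨κ, L, δ, hκ, hL0, hδ, hvar⟩ := exists_uniform_variation_bounds hA hg he hneA
  -- With new radius `θ * ‖τ‖`, moving inside a new ball undoes at most half of the effect of the
  -- shift.
  set θ := min 1 (κ / (2 * L)) with hθ
  have hθ0 : 0 < θ := lt_min one_pos (by positivity)
  have hθ1 : θ ≤ 1 := min_le_left _ _
  have hθκ : L * θ ≤ κ / 2 := by
    calc L * θ ≤ L * (κ / (2 * L)) := by
          gcongr
          exact min_le_right _ _
      _ = κ / 2 := by field_simp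
  obtain ⟨c, hc⟩ := NormedField.exists_one_lt_norm K
  have ev1 := eventually_ne_zero_of_landmark (G := fun x : Fin v × Fin n → K => g fun k i => x (k, i))
    hr₀ hr₁ hγ hD0 hsep herr happ hδ'0 hδδ hκ hL0 hδ hvar ‖c‖ hθ1 hθκ
  have ev2 := (tendsto_pow_nhdsGT_zero hr₀ hr₁).eventually
    (eventually_exists_step hP hS (B := ‖c‖) (sub_pos.2 hεσ) hαβ hη hηh hlow hup hθ0 hC)
  obtain ⟨j, hjJ, ⟨hj1, hj2⟩, hj0⟩ := ((Nat.frequently_atTop_iff_infinite.2 hJ).and_eventually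
    ((ev1.and ev2).and (eventually_gt_atTop 0))).exists
  have ht0 : 0 < r ^ j := pow_pos hr₀ j
  have htβ := Real.rpow_pos_of_pos ht0 (γ * D + δ')
  obtain ⟨τ, hτ1, hτ2⟩ := exists_norm_mem_shell hc htβ
  have hτe : ‖τ • (Pi.single p.2 1 : Fin n → K)‖ ≤ ‖c‖ * (r ^ j) ^ (γ * D + δ') := by
    rw [norm_smul, Pi.norm_single, norm_one, mul_one]
    exact hτ2
  obtain ⟨S', s', N, Ch, hS', hSt, hN1, hN2, hch⟩ := hj2 (θ * ‖τ‖) (by gcongr)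
    ((mul_le_of_le_one_left (norm_nonneg _) hθ1).trans hτ2)
    {w | ∀ i, ℓ₁ (w i) ≤ (j : ℕ∞)} (fun x hx => by
      have h1 : ∀ i, ∃ y ∈ ball (x i) (C * r ^ ((σ - ε₁) * (j : ℝ))), ℓ₁ y ≤ (j : ℕ∞) :=
        fun i => hCubi (x i) (hBΩ x hx i) j hj0
      choose w hw hwℓ using h1
      refine ⟨w, hwℓ, ?_⟩
      rw [mul_comm (σ - ε₁), Real.rpow_mul hr₀.le, Real.rpow_natCast] at hw
      exact (dist_pi_le_iff (mul_nonneg hC.le (Real.rpow_nonneg ht0.le _))).2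
        fun i => (mem_ball.1 (hw i)).le)
    U (τ • Pi.single p.2 1) hτe
  refine ⟨S', _, s', N, Ch, hS', hSt, hN1, hN2, ?_⟩
  intro T T' hT hT' hTp hTU hTne x hx
  choose w hwℓ hwT hwU hwU' using fun k => hch (T k) (hT k) (T' k) (hT' k)
  have hwA : w ∈ A := Set.mem_iUnion₂.2 ⟨T, ⟨hT, hTne⟩, fun k _ => mem_closedBall.2 (hwT k)⟩
  have hT'w : T' = w + τ • e := by
    funext k
    by_cases hk : k = p.1
    · subst hk
      rw [hwU p.1 hTp]
      simp [e]
    · rw [hwU' k (hTU k hk)]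
      simp [e, hk]
  have hxe : x = w + τ • e + (x - T') := by rw [← hT'w]; abel
  rw [hxe]
  refine hj1 hjJ τ hτ1 hτ2 w hwA (fun q => w q.1 q.2) rfl (fun q => ?_) (fun q => hwℓ q.1 q.2)
    (x - T') ?_
  · refine hBΩ (w q.1) ?_ q.2
    rw [mem_ball]
    linarith [dist_triangle (w q.1) (T q.1) x₀, hwT q.1, hS.dist_add_radius_lt _ (hT q.1)]
  · rw [← dist_eq_norm]
    exact (dist_pi_le_iff (by positivity)).2 hx

end LandmarkStep

/-! ### Iteration of steps -/

section Construction

variable {K : Type*} [NontriviallyNormedField K] {n : ℕ}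

/-- Iterating steps gives a limit set of dimension `h`, together with any property `C` that each step
can be made to have. -/
theorem exists_cantorScheme [ProperSpace K] {a b : ℝ} (hP : PackingBounds n K a b)
    (x₀ : Fin n → K) {ρ : ℝ} (hρ : 0 < ρ) {h : ℝ} (hh : 0 < h) (hhn : h ≤ n)
    (C : ℕ → Finset (Fin n → K) → ℝ → ℝ → ((Fin n → K) → Finset (Fin n → K)) → Prop)
    (hstep : ∀ (l : ℕ) (η : ℝ) (S : Finset (Fin n → K)) (R s : ℝ), 0 < η → η < h →
      IsLevel x₀ ρ S R s →
      ∃ S' R' s' N Ch, IsLevel x₀ ρ S' R' s' ∧ IsStep (a / 4 ^ n) S R S' R' s' N Ch ∧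
        1 ≤ N * R' ^ (h - η) ∧ S.card * N * R' ^ (h + η) ≤ 1 ∧ C l S R R' Ch) :
    ∃ S R s N Ch, IsCantorScheme S R s N Ch ∧ (∀ l, IsLevel x₀ ρ (S l) (R l) (s l)) ∧
      (∀ l, C l (S l) (R l) (R (l + 1)) (Ch l)) ∧ dimH (limitSet S R) = ENNReal.ofReal h := by
  -- The exponent losses tend to 0; the 2 keeps them below `h` already at `l = 0`.
  let η : ℕ → ℝ := fun l => h / (l + 2)
  have hη0 : ∀ l, 0 < η l := fun l => by positivity
  have hη1 : ∀ l, η l < h := fun l => div_lt_self hh (by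
    have : (0 : ℝ) ≤ l := Nat.cast_nonneg l
    linarith)
  have hηlim : Tendsto η atTop (𝓝 0) :=
    tendsto_const_nhds.div_atTop (tendsto_atTop_add_const_right _ _ tendsto_natCast_atTop_atTop)
  let Lev := {Z : Finset (Fin n → K) × ℝ × ℝ // IsLevel x₀ ρ Z.1 Z.2.1 Z.2.2}
  have hnext : ∀ (l : ℕ) (Z : Lev), ∃ Z' : Lev, ∃ N Ch,
      IsStep (a / 4 ^ n) Z.1.1 Z.1.2.1 Z'.1.1 Z'.1.2.1 Z'.1.2.2 N Ch ∧
        1 ≤ N * Z'.1.2.1 ^ (h - η l) ∧ Z.1.1.card * N * Z'.1.2.1 ^ (h + η l) ≤ 1 ∧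
        C l Z.1.1 Z.1.2.1 Z'.1.2.1 Ch := by
    rintro l ⟨⟨S, R, s⟩, hZ⟩
    obtain ⟨S', R', s', N, Ch, h1, h2⟩ := hstep l (η l) S R s (hη0 l) (hη1 l) hZ
    exact ⟨⟨(S', R', s'), h1⟩, N, Ch, h2⟩
  choose next hnext using hnext
  have hinit : IsLevel x₀ ρ {x₀} (min (ρ / 2) (1 / 2)) (8 * min (ρ / 2) (1 / 2)) := by
    refine ⟨Finset.singleton_nonempty _, lt_min (by linarith) (by norm_num), min_le_right _ _, le_rfl,
      ?_, ?_⟩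
    · intro c hc c' hc' hne
      rw [Finset.mem_singleton] at hc hc'
      exact absurd (hc.trans hc'.symm) hne
    · intro c hc
      rw [Finset.mem_singleton] at hc
      rw [hc, dist_self]
      linarith [min_le_left (ρ / 2) (1 / 2 : ℝ)]
  let Z : ℕ → Lev := fun l => Nat.rec
    ⟨({x₀}, min (ρ / 2) (1 / 2), 8 * min (ρ / 2) (1 / 2)), hinit⟩ next l
  choose N Ch hNCh using fun l => hnext l (Z l)
  let S : ℕ → Finset (Fin n → K) := fun l => (Z l).1.1
  let R : ℕ → ℝ := fun l => (Z l).1.2.1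
  let s : ℕ → ℝ := fun l => (Z l).1.2.2
  have hlev : ∀ l, IsLevel x₀ ρ (S l) (R l) (s l) := fun l => (Z l).2
  have hst : ∀ l, IsStep (a / 4 ^ n) (S l) (R l) (S (l + 1)) (R (l + 1)) (s (l + 1)) (N l) (Ch l) :=
    fun l => (hNCh l).1
  have hlow : ∀ l, 1 ≤ N l * R (l + 1) ^ (h - η l) := fun l => (hNCh l).2.1
  have hup : ∀ l, (S l).card * N l * R (l + 1) ^ (h + η l) ≤ 1 := fun l => (hNCh l).2.2.1
  have hsch : IsCantorScheme S R s N Ch :=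
    { nonempty := (hlev 0).nonempty
      radius_pos := fun l => (hlev l).radius_pos
      card_pos := fun l => (hst l).card_pos
      eight_radius_le := fun l => (hlev l).eight_radius_le
      sep_le_radius := fun l => (hst l).sep_le_radius
      separated := fun l => (hlev l).separated
      mem_succ := fun l => (hst l).mem_succ
      card_children := fun l => (hst l).card_children
      dist_add_radius_le := fun l => (hst l).dist_add_radius_le }
  refine ⟨S, R, s, N, Ch, hsch, hlev, fun l => (hNCh l).2.2.2, le_antisymm ?_ ?_⟩
  · refine hsch.dimH_limitSet_le hh.le fun u hu => ?_
    obtain ⟨l₀, hl₀⟩ := eventually_atTop.1 (hηlim.eventually (gt_mem_nhds (sub_pos.2 hu)))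
    filter_upwards [eventually_ge_atTop (l₀ + 1)] with l hl
    obtain ⟨l, rfl⟩ := Nat.exists_eq_add_of_le' (le_trans (Nat.le_add_left 1 l₀) hl)
    have h1 := hl₀ l (by omega)
    have hR := hsch.radius_pos (l + 1)
    have h2 : R (l + 1) ^ u ≤ R (l + 1) ^ (h + η l) :=
      Real.rpow_le_rpow_of_exponent_ge hR (by linarith [(hlev (l + 1)).radius_le]) (by linarith)
    refine le_trans ?_ (hup l)
    rw [hsch.card_level_succ]
    push_cast
    gcongr
  · refine hsch.le_dimH_limitSet hP (a' := a / 4 ^ n) (by have := hP.pos_left; positivity) hhn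
      (fun l => (hst l).le_card) fun u hu hus => ?_
    obtain ⟨l₀, hl₀⟩ := eventually_atTop.1 (hηlim.eventually (gt_mem_nhds (sub_pos.2 hus)))
    filter_upwards [eventually_ge_atTop (l₀ + 1)] with l hl
    obtain ⟨l, rfl⟩ := Nat.exists_eq_add_of_le' (le_trans (Nat.le_add_left 1 l₀) hl)
    have h1 := hl₀ l (by omega)
    have hR := hsch.radius_pos (l + 1)
    have h2 : R (l + 1) ^ (h - η l) ≤ R (l + 1) ^ u :=
      Real.rpow_le_rpow_of_exponent_ge hR (by linarith [(hlev (l + 1)).radius_le]) (by linarith)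
    have h3 : (1 : ℝ) ≤ (S l).card := by
      exact_mod_cast Finset.card_pos.2 (hlev l).nonempty
    refine (hlow l).trans ?_
    rw [hsch.card_level_succ]
    push_cast
    have := Real.rpow_pos_of_pos hR u
    calc (N l : ℝ) * R (l + 1) ^ (h - η l) ≤ 1 * N l * R (l + 1) ^ u := by
          rw [one_mul]
          gcongr
      _ ≤ _ := by gcongr

end Construction

/-! ### Chains of partial derivatives -/

section Chain

variable {K : Type*} [NontriviallyNormedField K] {v n : ℕ}

theorem StrictlyDifferentiable.chainDeriv_take {c : List (Fin v × Fin n)}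
    {f : (Fin v → Fin n → K) → K} (hf : StrictlyDifferentiable c.length f) {j : ℕ}
    (hj : j < c.length) (x : Fin v → Fin n → K) :
    ∃ f', HasStrictFDerivAt (𝕜 := K) (chainDeriv (c.take j) f) f' x := by
  induction c generalizing f j with
  | nil => simp at hj
  | cons p c ih =>
    cases j with
    | zero => exact hf.1 x
    | succ j => exact ih (hf.2 p) (Nat.lt_of_succ_lt_succ hj)

theorem chainDeriv_take_succ (c : List (Fin v × Fin n)) (f : (Fin v → Fin n → K) → K) {j : ℕ}
    (hj : j < c.length) :
    chainDeriv (c.take (j + 1)) f = pderiv (c.get ⟨j, hj⟩) (chainDeriv (c.take j) f) := by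
  rw [← List.take_append_getElem hj, chainDeriv, List.foldl_append]
  rfl

end Chain

/-! ### Descent from the last derivative to the function -/

section Avoidance

variable {K : Type*} [NontriviallyNormedField K] {n : ℕ}

/-- If, for each open set of a basis and each `j`, infinitely many steps of the construction carry
the nonvanishing of `D (j + 1)` to `D j`, then `D 0` has no zeros at tuples of distinct points of
the limit set. -/
theorem IsCantorScheme.ne_zero_of_chain {S : ℕ → Finset (Fin n → K)} {R s : ℕ → ℝ} {N : ℕ → ℕ}
    {Ch : ℕ → (Fin n → K) → Finset (Fin n → K)} (h : IsCantorScheme S R s N Ch) {x₀ : Fin n → K}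
    {ρ : ℝ} (hlev : ∀ l, IsLevel x₀ ρ (S l) (R l) (s l)) {B : Set (Set (Fin n → K))}
    (hB : TopologicalSpace.IsTopologicalBasis B) {v : ℕ}
    (D : ℕ → (Fin v → Fin n → K) → K) (m : ℕ) (k₀ : ℕ → Fin v)
    (hm : ∀ x : Fin v → Fin n → K, (∀ k, x k ∈ ball x₀ ρ) → D m x ≠ 0)
    (hstep : ∀ j < m, ∀ U ∈ B, ∀ L : ℕ, ∃ l, L ≤ l ∧ ∀ T T' : Fin v → Fin n → K,
      (∀ k, T k ∈ S l) → (∀ k, T' k ∈ Ch l (T k)) → T (k₀ j) ∈ U → (∀ k, k ≠ k₀ j → T k ∉ U) →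
      (∀ x : Fin v → Fin n → K, (∀ k, dist (x k) (T k) ≤ R l) → D (j + 1) x ≠ 0) →
      ∀ x : Fin v → Fin n → K, (∀ k, dist (x k) (T' k) ≤ R (l + 1)) → D j x ≠ 0)
    {x : Fin v → Fin n → K} (hx : Function.Injective x) (hxE : ∀ k, x k ∈ limitSet S R) :
    D 0 x ≠ 0 := by
  let P : ℕ → ℕ → Prop := fun j l => ∀ T : Fin v → Fin n → K, (∀ k, T k ∈ S l) →
    (∀ k, dist (x k) (T k) ≤ R l) →
    ∀ y : Fin v → Fin n → K, (∀ k, dist (y k) (T k) ≤ R l) → D j y ≠ 0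
  have hparent : ∀ l (T' : Fin v → Fin n → K), (∀ k, T' k ∈ S (l + 1)) →
      ∃ T : Fin v → Fin n → K, (∀ k, T k ∈ S l) ∧ (∀ k, T' k ∈ Ch l (T k)) ∧
        ∀ (k : Fin v) (y : Fin n → K), dist y (T' k) ≤ R (l + 1) → dist y (T k) ≤ R l := by
    intro l T' hT'
    choose T hT hTT' using fun k => (h.mem_succ l (T' k)).1 (hT' k)
    refine ⟨T, hT, hTT', fun k y hy => ?_⟩
    linarith [h.dist_add_radius_le l (T k) (hT k) (T' k) (hTT' k), dist_triangle y (T' k) (T k)]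
  have hmono : ∀ j l, P j l → P j (l + 1) := by
    intro j l hP T' hT' hxT' y hy
    obtain ⟨T, hT, -, hin⟩ := hparent l T' hT'
    exact hP T hT (fun k => hin k _ (hxT' k)) y fun k => hin k _ (hy k)
  -- The closure of `U` must miss the other points, since it is the centres of nearby balls, not the
  -- points themselves, that have to lie outside `U`.
  have hsep : ∀ j, ∃ U ∈ B, ∀ᶠ l in atTop, ∀ T : Fin v → Fin n → K,
      (∀ k, dist (x k) (T k) ≤ R l) → T (k₀ j) ∈ U ∧ ∀ k, k ≠ k₀ j → T k ∉ U := by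
    intro j
    have hopen : (x '' {k₀ j}ᶜ)ᶜ ∈ 𝓝 (x (k₀ j)) := by
      refine ((Set.toFinite _).isClosed.isOpen_compl).mem_nhds ?_
      rintro ⟨k, hk, hkx⟩
      exact hk (hx hkx)
    obtain ⟨U, hU, hxU, hUcl⟩ := hB.exists_closure_subset hopen
    refine ⟨U, hU, ?_⟩
    have hnear : ∀ (k : Fin v) (V : Set (Fin n → K)), V ∈ 𝓝 (x k) →
        ∀ᶠ l in atTop, ∀ T : Fin n → K, dist (x k) T ≤ R l → T ∈ V := by
      intro k V hV
      obtain ⟨ε, hε, hεV⟩ := Metric.mem_nhds_iff.1 hV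
      filter_upwards [h.tendsto_radius.eventually (gt_mem_nhds hε)] with l hl T hT
      exact hεV (by rw [mem_ball, dist_comm]; exact hT.trans_lt hl)
    have hoff : ∀ k, ∀ᶠ l in atTop, ∀ T : Fin n → K, dist (x k) T ≤ R l → k ≠ k₀ j → T ∉ U := by
      intro k
      by_cases hk : k = k₀ j
      · exact Eventually.of_forall fun l T _ hne => absurd hk hne
      · have hxk : (closure U)ᶜ ∈ 𝓝 (x k) :=
          isClosed_closure.isOpen_compl.mem_nhds fun hcl => hUcl hcl ⟨k, hk, rfl⟩
        filter_upwards [hnear k _ hxk] with l hl T hT _ hTU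
        exact hl T hT (subset_closure hTU)
    filter_upwards [hnear (k₀ j) U ((hB.isOpen hU).mem_nhds hxU), eventually_all.2 hoff]
      with l h1 h2 T hT
    exact ⟨h1 _ (hT _), fun k hk => h2 k _ (hT k) hk⟩
  -- Induction down the chain, starting from `D m`, which has no zeros by `hm`.
  have key : ∀ i ≤ m, ∃ l₁, ∀ l, l₁ ≤ l → P (m - i) l := by
    intro i
    induction i with
    | zero =>
      refine fun _ => ⟨0, fun l _ T hT _ y hy => hm y fun k => ?_⟩
      rw [mem_ball]
      linarith [(hlev l).dist_add_radius_lt (T k) (hT k), hy k, dist_triangle (y k) (T k) x₀]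
    | succ i ih =>
      intro hi
      obtain ⟨l₁, hl₁⟩ := ih (Nat.le_of_succ_le hi)
      have hj : m - i = m - (i + 1) + 1 := by omega
      set j := m - (i + 1) with hjdef
      rw [hj] at hl₁
      obtain ⟨U, hU, hUev⟩ := hsep j
      obtain ⟨L, hL⟩ := eventually_atTop.1 hUev
      -- The step must come after `D (j + 1)` is known to be nonvanishing and after `U` isolates the
      -- right centre.
      obtain ⟨l, hl, hlstep⟩ := hstep j (by omega) U hU (max l₁ L)
      refine ⟨l + 1, fun l' hl' => ?_⟩
      induction l', hl' using Nat.le_induction with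
      | base =>
        intro T' hT' hxT' y hy
        obtain ⟨T, hT, hTT', hin⟩ := hparent l T' hT'
        have hxT : ∀ k, dist (x k) (T k) ≤ R l := fun k => hin k _ (hxT' k)
        obtain ⟨hT1, hT2⟩ := hL l ((le_max_right _ _).trans hl) T hxT
        exact hlstep T T' hT hTT' hT1 hT2 (hl₁ l ((le_max_left _ _).trans hl) T hT hxT) y hy
      | succ l' _ ih => exact hmono j l' ih
  obtain ⟨l, hl⟩ := key m le_rfl
  rw [Nat.sub_self] at hl
  choose T hT hxT using fun k => mem_levelSet.1 (Set.mem_iInter.1 (hxE k) l)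
  exact hl l le_rfl T hT hxT x hxT

end Avoidance

end Landmark

/-! ### The main theorem -/

open Landmark in
theorem mainTheorem1 {K : Type*} [NontriviallyNormedField K]
    (hK : Landmark.IsRealOrNonarchLocalField K) (n : ℕ)
    (v : ℕ → ℕ) (f : (q : ℕ) → (Fin (v q) → Fin n → K) → K)
    (c : (q : ℕ) → List (Fin (v q) × Fin n))
    (hf : ∀ q, Landmark.StrictlyDifferentiable (c q).length (f q))
    (x₀ : Fin n → K) (ρ : ℝ) (hρ : 0 < ρ)
    (hc : ∀ q, ∀ x : Fin (v q) → Fin n → K, (∀ k, x k ∈ Metric.ball x₀ ρ) →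
      Landmark.chainDeriv (c q) (f q) x ≠ 0)
    (r γ σ d : ℝ) (hr₀ : 0 < r) (hr₁ : r < 1) (hσ : 0 < σ) (hσγ : σ ≤ γ) (hd : σ ≤ d * γ)
    (ε : ℕ → ℝ) (hε₀ : ∀ m, 0 < ε m) (hε : Filter.Tendsto ε Filter.atTop (nhds 0))
    (Ω : ℕ → ℕ → ℕ → Set K) (hΩ : ∀ q m j, IsCompact (Ω q m j))
    (hBΩ : ∀ q m j, ∀ x ∈ Metric.ball x₀ ρ, ∀ i, x i ∈ Ω q m j)
    (ℓ₁ ℓ₂ : ℕ → ℕ → ℕ → K → ℕ∞)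
    (hℓ : ∀ q m j, j < (c q).length →
      Landmark.IsWeakApproxLandmarkPair r γ σ (d + ε m) (Ω q m j)
        (fun x : Fin (v q) × Fin n → K =>
          Landmark.chainDeriv ((c q).take j) (f q) (fun k i => x (k, i)))
        (ℓ₁ q m j) (ℓ₂ q m j)) :
    ∃ E : Set (Fin n → K), E ⊆ Metric.ball x₀ ρ ∧
      dimH E = ENNReal.ofReal ((n : ℝ) * σ / (d * γ)) ∧
      ∀ q, ∀ x : Fin (v q) → Fin n → K, Function.Injective x → (∀ k, x k ∈ E) → f q x ≠ 0 := by
  rcases Nat.eq_zero_or_pos n with rfl | hn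
  -- For `n = 0` there are no coordinates, so each chain is empty and `hc` concerns `f q` itself;
  -- this also covers the empty tuple.
  · refine ⟨∅, Set.empty_subset _, by simp, fun q x _ hx => ?_⟩
    have hnil : c q = [] := List.eq_nil_iff_forall_not_mem.2 fun p _ => p.2.elim0
    have := hc q x fun k => absurd (hx k) (Set.notMem_empty _)
    rwa [hnil] at this
  have := hK.properSpace
  obtain ⟨a, b, hP⟩ := hK.exists_packingBounds n
  have hγ : 0 < γ := hσ.trans_le hσγ
  have hdγ : 0 < d * γ := hσ.trans_le hd
  have hn' : (0 : ℝ) < n := by exact_mod_cast hn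
  set h : ℝ := n * σ / (d * γ) with hh
  have hh0 : 0 < h := by positivity
  have hhn : h ≤ n := by
    rw [hh, div_le_iff₀ hdγ]
    gcongr
  obtain ⟨B, hBc, -, hB⟩ := TopologicalSpace.exists_countable_basis (Fin n → K)
  obtain ⟨U₀, hU₀, -⟩ := hB.exists_subset_of_mem_open (Set.mem_univ x₀) isOpen_univ
  obtain ⟨U, rfl⟩ := hBc.exists_eq_range ⟨U₀, hU₀⟩
  obtain ⟨S, R, s, N, Ch, hsch, hlev, hC, hdim⟩ := exists_cantorScheme hP x₀ hρ hh0 hhn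
    -- The first component of `Nat.unpair l` codes the function, the place in its chain and the
    -- basis set; the second is free, so every code recurs beyond any level.
    (fun l S R R' Ch => ∀ q j i, (Nat.unpair l).1 = Nat.pair q (Nat.pair j i) →
      ∀ (hj : j < (c q).length) (T T' : Fin (v q) → Fin n → K), (∀ k, T k ∈ S) →
        (∀ k, T' k ∈ Ch (T k)) → T ((c q).get ⟨j, hj⟩).1 ∈ U i →
        (∀ k, k ≠ ((c q).get ⟨j, hj⟩).1 → T k ∉ U i) →
        (∀ x : Fin (v q) → Fin n → K, (∀ k, dist (x k) (T k) ≤ R) →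
          pderiv ((c q).get ⟨j, hj⟩) (chainDeriv ((c q).take j) (f q)) x ≠ 0) →
        ∀ x : Fin (v q) → Fin n → K, (∀ k, dist (x k) (T' k) ≤ R') →
          chainDeriv ((c q).take j) (f q) x ≠ 0)
    (by
      intro l η S R s hη hηh hS
      by_cases hex : ∃ q j i, (Nat.unpair l).1 = Nat.pair q (Nat.pair j i) ∧ j < (c q).length
      · obtain ⟨q, j, i, hl, hj⟩ := hex
        obtain ⟨S', R', s', N, Ch, h1, h2, h3, h4, h5⟩ := exists_step_of_landmarks hP hn hS hr₀ hr₁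
          hσ hγ hd hh hη hηh ((hf q).chainDeriv_take hj) ((c q).get ⟨j, hj⟩)
          (U i) hε₀ hε fun m => ⟨_, _, _, hBΩ q m j, hℓ q m j hj⟩
        refine ⟨S', R', s', N, Ch, h1, h2, h3, h4, fun q' j' i' hl' _ => ?_⟩
        obtain ⟨rfl, hji⟩ := Nat.pair_eq_pair.1 (hl.symm.trans hl')
        obtain ⟨rfl, rfl⟩ := Nat.pair_eq_pair.1 hji
        exact h5
      · obtain ⟨S', R', s', N, Ch, h1, h2, h3, h4⟩ := exists_step hP hn hS hσ hd hh hη hηh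
        exact ⟨S', R', s', N, Ch, h1, h2, h3, h4,
          fun q j i hl hj => absurd ⟨q, j, i, hl, hj⟩ hex⟩)
  refine ⟨limitSet S R, ?_, hdim, fun q x hx hxE => ?_⟩
  · intro x hx
    obtain ⟨c', hc', hxc⟩ := mem_levelSet.1 (Set.mem_iInter.1 hx 0)
    rw [Metric.mem_ball]
    linarith [(hlev 0).dist_add_radius_lt c' hc', dist_triangle x c' x₀]
  -- An empty chain is treated apart, since the coordinate assigned below to `j` past the end of the
  -- chain is its first entry.
  rcases Nat.eq_zero_or_pos (c q).length with hlen | hlen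
  · have hball : ∀ k, x k ∈ Metric.ball x₀ ρ := by
      intro k
      obtain ⟨c', hc', hxc⟩ := mem_levelSet.1 (Set.mem_iInter.1 (hxE k) 0)
      rw [Metric.mem_ball]
      linarith [(hlev 0).dist_add_radius_lt c' hc', dist_triangle (x k) c' x₀]
    have := hc q x hball
    rwa [List.length_eq_zero_iff.1 hlen] at this
  have hfin := hsch.ne_zero_of_chain hlev hB (fun j => chainDeriv ((c q).take j) (f q))
    (c q).length (fun j => if hj : j < (c q).length then ((c q).get ⟨j, hj⟩).1 else
      ((c q).get ⟨0, hlen⟩).1) (by simpa using hc q) ?_ hx hxE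
  · simpa [chainDeriv] using hfin
  rintro j hj _ ⟨i, rfl⟩ L
  refine ⟨Nat.pair (Nat.pair q (Nat.pair j i)) L, Nat.right_le_pair _ _, ?_⟩
  simp only [hj, dif_pos]
  intro T T' hT hT' hT1 hT2 hne
  refine hC _ q j i (by rw [Nat.unpair_pair]) hj T T' hT hT' hT1 hT2 ?_
  rwa [← chainDeriv_take_succ]
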